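/- Let $(\Omega,\Sigma)$ be a measurable space, $\mathcal H$ a separable complex Hilbert space, and $\mathcal I:\Sigma\to\mathcal L(\mathcal T(\mathcal H))$ an instrument on the trace class $\mathcal T(\mathcal H)$, i.e. a weakly $\sigma$-additive map whose values are bounded, completely positive, trace non-increasing linear maps, with $\mathcal I(\Omega)$ trace preserving. Let $\mathsf M:\Sigma\to\mathcal L(\mathcal H)$ be its associated observable, i.e. the POVM with $\operatorname{tr}[\mathsf M(X)\rho]=\operatorname{tr}[\mathcal I(X)(\rho)]$ for all $X\in\Sigma$ and all states $\rho$. For a $\sigma$-finite measure $\mu$ on $\Sigma$ and a measurable function $n:\Omega\to\{0,1,2,\dots,\infty\}$ let $\int_\Omega^\oplus\mathcal H_{n(x)}\,d\mu(x)$ be the direct integral of the standard Hilbert spaces $\mathcal H_k\subseteq\ell^2(\mathbb N)$ of dimension $k$, with its canonical spectral measure $X\mapsto\hat\chi_X$ (multiplication by the characteristic function of $X$). All measures $\mu$ below are $\sigma$-finite and mutually absolutely continuous with $\mathsf M$, i.e. $\mu(X)=0\iff\mathsf M(X)=0$. Let $(\mathcal H'_\oplus,\mathsf P',Y)$ be a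 minimal Stinespring dilation of $\mathcal I$, where $\mathcal H'_\oplus=\int_\Omega^\oplus\mathcal H_{r(x)}\,d\mu(x)$ and $\mathsf P'$ is its canonical spectral measure; that is, $Y:\mathcal H\to\mathcal H\otimes\mathcal H'_\oplus$ is a linear isometry, $\mathcal I^*(X)(B)=Y^*(B\otimes\mathsf P'(X))Y$ for all $X\in\Sigma$, $B\in\mathcal L(\mathcal H)$ (where $\operatorname{tr}[\mathcal I^*(X)(B)T]=\operatorname{tr}[B\,\mathcal I(X)(T)]$ for all $T\in\mathcal T(\mathcal H)$), and the vectors $(B\otimes\mathsf P'(X))Y\psi$ span a dense subspace of $\mathcal H\otimes\mathcal H'_\oplus$. The observable $\mathsf M$ is called rank-$\infty$ if $m(x)=\infty$ for $\mu$-almost every $x$, where $m$ is the multiplicity function of its minimal Naimark dilation $(\mathcal H_\oplus,\mathsf P,J)$ on a direct integral $\mathcal H_\oplus=\int_\Omega^\oplus\mathcal H_{m(x)}\,d\mu(x)$ with canonical spectral measure $\mathsf P$; that is, $J:\mathcal H\to\mathcal H_\oplus$ is a linear isometry, $\mathsf M(X)=J^*\mathsf P(X)J$ for all $X\in\Sigma$,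 and the vectors $\mathsf P(X)J\psi$ span a dense subspace of $\mathcal H_\oplus$. (Such a dilation is unique up to unitary equivalence and equivalence of measures, so this does not depend on its choice.) If $\mathsf M$ is not rank-$\infty$, i.e. if $m(x)<\infty$ on a set of positive measure, then for every unit vector $\xi\in\mathcal H'_\oplus$ there exists a unitary operator $U$ on $\mathcal H\otimes\mathcal H'_\oplus$ such that $U(\psi\otimes\xi)=Y\psi$ for all $\psi\in\mathcal H$. -/

import Mathlib

open MeasureTheory Set Filter
open scoped TensorProduct InnerProductSpace ENNReal ComplexOrder Topology

noncomputable section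

namespace QM

/-! ### Hilbert space tensor products -/

/-- The Hilbert tensor product of `H` and `K`: the completion of the algebraic tensor product with
respect to its inner product. -/
abbrev HTensor (H K : Type*) [NormedAddCommGroup H] [InnerProductSpace ℂ H]
    [NormedAddCommGroup K] [InnerProductSpace ℂ K] : Type _ :=
  UniformSpace.Completion (H ⊗[ℂ] K)

section Tensor

variable {H K : Type*} [NormedAddCommGroup H] [InnerProductSpace ℂ H]
  [NormedAddCommGroup K] [InnerProductSpace ℂ K]

/-- The elementary tensor `ψ ⊗ ξ` in the Hilbert tensor product. -/
def tmul (ψ : H) (ξ : K) : HTensor H K := ((ψ ⊗ₜ[ℂ] ξ : H ⊗[ℂ] K) : HTensor H K)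

/-- The bounded operator `B ⊗ P` on the Hilbert tensor product. -/
def tensorOp (B : H →L[ℂ] H) (P : K →L[ℂ] K) : HTensor H K →L[ℂ] HTensor H K :=
  (TensorProduct.mapL B P).completion

theorem tensorOp_tmul (B : H →L[ℂ] H) (P : K →L[ℂ] K) (ψ : H) (ξ : K) :
    tensorOp B P (tmul ψ ξ) = tmul (B ψ) (P ξ) := by
  unfold tensorOp tmul
  rw [ContinuousLinearMap.completion_apply_coe]
  rfl

end Tensor

/-! ### Trace class operators and the trace -/

section TraceClass

variable {H : Type*} [NormedAddCommGroup H] [InnerProductSpace ℂ H]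

/-- The set of all sums `∑ |⟨e_i, T f_i⟩|` over pairs of finite orthonormal systems of equal length.
Its supremum is the trace norm of `T`. -/
def traceSums (T : H →L[ℂ] H) : Set ℝ :=
  {s | ∃ (n : ℕ) (e f : Fin n → H), Orthonormal ℂ e ∧ Orthonormal ℂ f ∧
    s = ∑ i, ‖⟪e i, T (f i)⟫_ℂ‖}

/-- The trace norm of a trace class operator. -/
def traceNorm (T : H →L[ℂ] H) : ℝ := sSup (traceSums T)

variable (H) in
/-- The space of trace class operators on `H`, i.e. the bounded operators of finite trace norm. -/
def TraceClass : Submodule ℂ (H →L[ℂ] H) where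
  carrier := {T | BddAbove (traceSums T)}
  zero_mem' := by
    refine ⟨0, ?_⟩
    rintro s ⟨n, e, f, -, -, rfl⟩
    simp
  add_mem' := by
    rintro S T ⟨a, ha⟩ ⟨b, hb⟩
    refine ⟨a + b, ?_⟩
    rintro s ⟨n, e, f, he, hf, rfl⟩
    calc ∑ i, ‖⟪e i, (S + T) (f i)⟫_ℂ‖
        ≤ ∑ i, (‖⟪e i, S (f i)⟫_ℂ‖ + ‖⟪e i, T (f i)⟫_ℂ‖) := by
          refine Finset.sum_le_sum fun i _ => ?_
          rw [add_apply, inner_add_right]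
          exact norm_add_le _ _
      _ = ∑ i, ‖⟪e i, S (f i)⟫_ℂ‖ + ∑ i, ‖⟪e i, T (f i)⟫_ℂ‖ := Finset.sum_add_distrib
      _ ≤ a + b := add_le_add (ha ⟨n, e, f, he, hf, rfl⟩) (hb ⟨n, e, f, he, hf, rfl⟩)
  smul_mem' := by
    rintro c T ⟨a, ha⟩
    refine ⟨‖c‖ * a, ?_⟩
    rintro s ⟨n, e, f, he, hf, rfl⟩
    have h : ∑ i, ‖⟪e i, (c • T) (f i)⟫_ℂ‖ = ‖c‖ * ∑ i, ‖⟪e i, T (f i)⟫_ℂ‖ := by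
      rw [Finset.mul_sum]
      refine Finset.sum_congr rfl fun i _ => ?_
      rw [smul_apply, inner_smul_right, norm_mul]
    rw [h]
    exact mul_le_mul_of_nonneg_left (ha ⟨n, e, f, he, hf, rfl⟩) (norm_nonneg c)

variable [CompleteSpace H]

/-- The index set of a fixed orthonormal basis of the Hilbert space `H`. -/
def basisIndex (H : Type*) [NormedAddCommGroup H] [InnerProductSpace ℂ H] [CompleteSpace H] :
    Set H := (exists_hilbertBasis ℂ H).choose

/-- A fixed orthonormal basis of the Hilbert space `H`. -/
def basis (H : Type*) [NormedAddCommGroup H] [InnerProductSpace ℂ H] [CompleteSpace H] :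
    HilbertBasis (basisIndex H) ℂ H := (exists_hilbertBasis ℂ H).choose_spec.choose

/-- The trace `tr T = ∑ ⟨h_n, T h_n⟩`. For trace class operators the sum converges absolutely and
does not depend on the orthonormal basis. -/
def trace (T : H →L[ℂ] H) : ℂ := ∑' i, ⟪basis H i, T (basis H i)⟫_ℂ

/-- The states (density operators) of `H`. -/
def IsState (ρ : TraceClass H) : Prop :=
  (ρ : H →L[ℂ] H).IsPositive ∧ trace (ρ : H →L[ℂ] H) = 1

/-- Complete positivity of a linear map `Φ` on the trace class: for every `n`, applying `Φ` to the
entries of a positive operator matrix `(T_ij)` on `H ⊕ ⋯ ⊕ H` (`n` summands) gives a positive operator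
matrix. -/
def IsCompletelyPositive (Φ : TraceClass H →ₗ[ℂ] TraceClass H) : Prop :=
  ∀ (n : ℕ) (T : Fin n → Fin n → TraceClass H),
    (∀ ψ : Fin n → H, 0 ≤ ∑ i, ∑ j, ⟪ψ i, (T i j : H →L[ℂ] H) (ψ j)⟫_ℂ) →
    ∀ ψ : Fin n → H, 0 ≤ ∑ i, ∑ j, ⟪ψ i, (Φ (T i j) : H →L[ℂ] H) (ψ j)⟫_ℂ

/-- The relation `A = Φ^*(B)` between `A, B ∈ L(H)` and a map `Φ` on the trace class:
`tr (A T) = tr (B Φ(T))` for all trace class operators `T`. -/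
def IsHeisenbergDual (Φ : TraceClass H →ₗ[ℂ] TraceClass H) (B A : H →L[ℂ] H) : Prop :=
  ∀ T : TraceClass H, trace (A ∘L (T : H →L[ℂ] H)) = trace (B ∘L (Φ T : H →L[ℂ] H))

end TraceClass

/-! ### Observables -/

/-- A normalized positive operator valued measure on the measurable space `Ω`, acting on `H`. -/
structure POVM (Ω : Type*) [MeasurableSpace Ω] (H : Type*) [NormedAddCommGroup H]
    [InnerProductSpace ℂ H] where
  toFun : ∀ X : Set Ω, MeasurableSet X → (H →L[ℂ] H)
  isPositive : ∀ X hX, (toFun X hX).IsPositive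
  univ_eq_one : toFun Set.univ MeasurableSet.univ = 1
  hasSum_iUnion : ∀ (s : ℕ → Set Ω) (hs : ∀ i, MeasurableSet (s i)),
    Pairwise (Function.onFun Disjoint s) → ∀ φ ψ : H,
      HasSum (fun i => ⟪φ, toFun (s i) (hs i) ψ⟫_ℂ)
        ⟪φ, toFun (⋃ i, s i) (MeasurableSet.iUnion hs) ψ⟫_ℂ

section POVM

variable {Ω : Type*} [MeasurableSpace Ω]
  {H : Type*} [NormedAddCommGroup H] [InnerProductSpace ℂ H]
  {K : Type*} [NormedAddCommGroup K] [InnerProductSpace ℂ K]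

/-- A sharp observable (projection valued measure): all effects are projections (they are
self-adjoint by positivity). -/
def POVM.IsSharp (P : POVM Ω H) : Prop :=
  ∀ X hX, P.toFun X hX ∘L P.toFun X hX = P.toFun X hX

/-- The measure `μ` and the observable `M` are mutually absolutely continuous. -/
def MutuallyAC (μ : Measure Ω) (M : POVM Ω H) : Prop :=
  ∀ X hX, μ X = 0 ↔ M.toFun X hX = 0

variable [CompleteSpace H]

/-- `(K, P, J)` is a Naimark dilation of `M`. -/
def IsNaimarkDilation [CompleteSpace K] (M : POVM Ω H) (P : POVM Ω K) (J : H →ₗᵢ[ℂ] K) : Prop :=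
  P.IsSharp ∧ ∀ X hX, M.toFun X hX =
    ContinuousLinearMap.adjoint J.toContinuousLinearMap ∘L P.toFun X hX ∘L J.toContinuousLinearMap

/-- `(K, P, J)` is a minimal Naimark dilation of `M`. -/
def IsMinimalNaimarkDilation [CompleteSpace K] (M : POVM Ω H) (P : POVM Ω K) (J : H →ₗᵢ[ℂ] K) :
    Prop :=
  IsNaimarkDilation M P J ∧
    (Submodule.span ℂ {v : K | ∃ X hX ψ, v = P.toFun X hX (J ψ)}).topologicalClosure = ⊤

end POVM

/-! ### Instruments -/

/-- A quantum instrument in the Schrödinger picture: a weakly σ-additive map from the σ-algebra of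
`Ω` into the bounded completely positive trace non-increasing linear maps on the trace class of `H`,
which is trace preserving on the whole of `Ω`. -/
structure Instrument (Ω : Type*) [MeasurableSpace Ω] (H : Type*) [NormedAddCommGroup H]
    [InnerProductSpace ℂ H] [CompleteSpace H] where
  toFun : ∀ X : Set Ω, MeasurableSet X → (TraceClass H →ₗ[ℂ] TraceClass H)
  bounded : ∀ X hX, ∃ C : ℝ, ∀ T : TraceClass H,
    traceNorm (toFun X hX T : H →L[ℂ] H) ≤ C * traceNorm (T : H →L[ℂ] H)
  completelyPositive : ∀ X hX, IsCompletelyPositive (toFun X hX)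
  trace_le : ∀ X hX, ∀ T : TraceClass H, (T : H →L[ℂ] H).IsPositive →
    trace (toFun X hX T : H →L[ℂ] H) ≤ trace (T : H →L[ℂ] H)
  trace_univ : ∀ T : TraceClass H,
    trace (toFun Set.univ MeasurableSet.univ T : H →L[ℂ] H) = trace (T : H →L[ℂ] H)
  hasSum_iUnion : ∀ (s : ℕ → Set Ω) (hs : ∀ i, MeasurableSet (s i)),
    Pairwise (Function.onFun Disjoint s) → ∀ (T : TraceClass H) (B : H →L[ℂ] H),
      HasSum (fun i => trace (B ∘L (toFun (s i) (hs i) T : H →L[ℂ] H)))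
        (trace (B ∘L (toFun (⋃ i, s i) (MeasurableSet.iUnion hs) T : H →L[ℂ] H)))

section Instrument

variable {Ω : Type*} [MeasurableSpace Ω]
  {H : Type*} [NormedAddCommGroup H] [InnerProductSpace ℂ H] [CompleteSpace H]
  {K : Type*} [NormedAddCommGroup K] [InnerProductSpace ℂ K]

/-- `M` is the observable associated with the instrument `I`: `tr (M(X) ρ) = tr (I(X)(ρ))` for all
states `ρ`. -/
def IsAssociatedObservable (I : Instrument Ω H) (M : POVM Ω H) : Prop :=
  ∀ X hX, ∀ ρ : TraceClass H, IsState ρ →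
    trace (M.toFun X hX ∘L (ρ : H →L[ℂ] H)) = trace (I.toFun X hX ρ : H →L[ℂ] H)

/-- `(K, P, Y)` is a Stinespring dilation of `I`: `P` is a projection valued measure and
`I(X)^*(B) = Y^* (B ⊗ P(X)) Y` for all `X` and `B`. -/
def IsStinespringDilation (I : Instrument Ω H) (P : POVM Ω K) (Y : H →ₗᵢ[ℂ] HTensor H K) : Prop :=
  P.IsSharp ∧ ∀ X hX, ∀ B : H →L[ℂ] H, IsHeisenbergDual (I.toFun X hX) B
    (ContinuousLinearMap.adjoint Y.toContinuousLinearMap ∘L tensorOp B (P.toFun X hX) ∘L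
      Y.toContinuousLinearMap)

/-- `(K, P, Y)` is a minimal Stinespring dilation of `I`. -/
def IsMinimalStinespringDilation (I : Instrument Ω H) (P : POVM Ω K) (Y : H →ₗᵢ[ℂ] HTensor H K) :
    Prop :=
  IsStinespringDilation I P Y ∧
    (Submodule.span ℂ {v : HTensor H K |
      ∃ (B : H →L[ℂ] H) (X : Set Ω) (hX : MeasurableSet X) (ψ : H),
        v = tensorOp B (P.toFun X hX) (Y ψ)}).topologicalClosure = ⊤

end Instrument

/-! ### Direct integrals and canonical spectral measures -/

/-- The standard separable infinite-dimensional Hilbert space `ℓ²(ℕ)`. -/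
abbrev EllTwo : Type := lp (fun _ : ℕ => ℂ) 2

/-- The standard Hilbert space of dimension `n ∈ {0, 1, …, ∞}`: the closed subspace of `ℓ²(ℕ)` of all
sequences that vanish from the index `n` on. -/
def fiber (n : ℕ∞) : Submodule ℂ EllTwo where
  carrier := {v | ∀ k : ℕ, n ≤ (k : ℕ∞) → v k = 0}
  zero_mem' := fun k _ => rfl
  add_mem' := by
    intro v w hv hw k hk
    simp [hv k hk, hw k hk]
  smul_mem' := by
    intro c v hv k hk
    simp [hv k hk]

section DirectIntegral

variable {Ω : Type*} [MeasurableSpace Ω]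

/-- The direct integral `∫^⊕ H_{m(x)} dμ(x)`: the space of (classes of) square integrable functions
`f : Ω → ℓ²(ℕ)` with `f x` in the standard `m x`-dimensional space for almost every `x`. -/
def directIntegral (μ : Measure Ω) (m : Ω → ℕ∞) : Submodule ℂ (Lp EllTwo 2 μ) where
  carrier := {f | ∀ᵐ x ∂μ, f x ∈ fiber (m x)}
  zero_mem' := by
    filter_upwards [Lp.coeFn_zero EllTwo 2 μ] with x hx
    rw [hx]
    exact (fiber (m x)).zero_mem
  add_mem' := by
    intro f g hf hg
    filter_upwards [hf, hg, Lp.coeFn_add f g] with x h1 h2 h3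
    rw [h3]
    exact (fiber (m x)).add_mem h1 h2
  smul_mem' := by
    intro c f hf
    filter_upwards [hf, Lp.coeFn_smul c f] with x h1 h2
    rw [h2]
    exact (fiber (m x)).smul_mem c h1

/-- The direct integral as a Hilbert space. -/
abbrev DirectIntegral (μ : Measure Ω) (m : Ω → ℕ∞) : Type _ := ↥(directIntegral μ m)

theorem isClosed_fiber (n : ℕ∞) : IsClosed (fiber n : Set EllTwo) := by
  have h : (fiber n : Set EllTwo) = ⋂ k : ℕ, ⋂ _ : n ≤ (k : ℕ∞), {v : EllTwo | v k = 0} := by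
    ext v
    simp only [Set.mem_iInter, Set.mem_ofPred_eq]
    exact Iff.rfl
  rw [h]
  refine isClosed_iInter fun k => isClosed_iInter fun _ => ?_
  exact isClosed_eq ((lp.evalCLM ℂ (fun _ : ℕ => ℂ) 2 k).continuous) continuous_const

theorem isClosed_directIntegral (μ : Measure Ω) (m : Ω → ℕ∞) :
    IsClosed (directIntegral μ m : Set (Lp EllTwo 2 μ)) := by
  refine IsSeqClosed.isClosed ?_
  intro f g hf hfg
  obtain ⟨φ, -, hφ⟩ := (tendstoInMeasure_of_tendsto_Lp hfg).exists_seq_tendsto_ae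
  have hall : ∀ᵐ x ∂μ, ∀ n, f n x ∈ fiber (m x) := ae_all_iff.2 fun n => hf n
  filter_upwards [hφ, hall] with x h1 h2
  exact (isClosed_fiber (m x)).mem_of_tendsto h1 (Eventually.of_forall fun n => h2 (φ n))

instance (μ : Measure Ω) (m : Ω → ℕ∞) : CompleteSpace (DirectIntegral μ m) :=
  (isClosed_directIntegral μ m).completeSpace_coe

/-- Multiplication of a vector of the direct integral by the characteristic function of `X`. -/
def mulIndicator (μ : Measure Ω) (m : Ω → ℕ∞) (X : Set Ω) (hX : MeasurableSet X)
    (f : DirectIntegral μ m) : DirectIntegral μ m :=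
  ⟨((Lp.memLp (f : Lp EllTwo 2 μ)).indicator hX).toLp _, by
    have hf : ∀ᵐ x ∂μ, (f : Lp EllTwo 2 μ) x ∈ fiber (m x) := f.2
    change ∀ᵐ x ∂μ, _
    filter_upwards [hf, ((Lp.memLp (f : Lp EllTwo 2 μ)).indicator hX).coeFn_toLp] with x h1 h2
    rw [h2]
    by_cases hx : x ∈ X
    · rwa [Set.indicator_of_mem hx]
    · rw [Set.indicator_of_notMem hx]
      exact (fiber (m x)).zero_mem⟩

theorem mulIndicator_ae (μ : Measure Ω) (m : Ω → ℕ∞) (X : Set Ω) (hX : MeasurableSet X)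
    (f : DirectIntegral μ m) :
    ((mulIndicator μ m X hX f : Lp EllTwo 2 μ) : Ω → EllTwo) =ᵐ[μ]
      X.indicator (f : Lp EllTwo 2 μ) :=
  ((Lp.memLp (f : Lp EllTwo 2 μ)).indicator hX).coeFn_toLp

/-- The bounded operator of multiplication by the characteristic function of `X`. -/
def chi (μ : Measure Ω) (m : Ω → ℕ∞) (X : Set Ω) (hX : MeasurableSet X) :
    DirectIntegral μ m →L[ℂ] DirectIntegral μ m :=
  LinearMap.mkContinuous
    { toFun := mulIndicator μ m X hX
      map_add' := by
        intro f g
        apply Subtype.ext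
        apply Lp.ext
        rw [Submodule.coe_add]
        filter_upwards [mulIndicator_ae μ m X hX (f + g), mulIndicator_ae μ m X hX f,
          mulIndicator_ae μ m X hX g,
          Lp.coeFn_add (f : Lp EllTwo 2 μ) (g : Lp EllTwo 2 μ),
          Lp.coeFn_add (mulIndicator μ m X hX f : Lp EllTwo 2 μ)
            (mulIndicator μ m X hX g : Lp EllTwo 2 μ)] with x h1 h2 h3 h4 h5
        rw [h1, h5, Pi.add_apply, h2, h3]
        by_cases hx : x ∈ X
        · simp only [Set.indicator_of_mem hx]
          exact h4
        · simp only [Set.indicator_of_notMem hx, add_zero]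
      map_smul' := by
        intro c f
        apply Subtype.ext
        apply Lp.ext
        rw [RingHom.id_apply, Submodule.coe_smul]
        filter_upwards [mulIndicator_ae μ m X hX (c • f), mulIndicator_ae μ m X hX f,
          Lp.coeFn_smul c (f : Lp EllTwo 2 μ),
          Lp.coeFn_smul c (mulIndicator μ m X hX f : Lp EllTwo 2 μ)] with x h1 h2 h3 h4
        rw [h1, h4, Pi.smul_apply, h2]
        by_cases hx : x ∈ X
        · simp only [Set.indicator_of_mem hx]
          exact h3
        · simp only [Set.indicator_of_notMem hx, smul_zero] }
    1 (by
      intro f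
      rw [one_mul]
      change ‖(mulIndicator μ m X hX f : Lp EllTwo 2 μ)‖ ≤ ‖(f : Lp EllTwo 2 μ)‖
      refine Lp.norm_le_norm_of_ae_le ?_
      filter_upwards [mulIndicator_ae μ m X hX f] with x h1
      rw [h1]
      exact norm_indicator_le_norm_self _ _)

theorem chi_ae (μ : Measure Ω) (m : Ω → ℕ∞) (X : Set Ω) (hX : MeasurableSet X)
    (f : DirectIntegral μ m) :
    ((chi μ m X hX f : Lp EllTwo 2 μ) : Ω → EllTwo) =ᵐ[μ] X.indicator (f : Lp EllTwo 2 μ) :=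
  mulIndicator_ae μ m X hX f

theorem inner_chi (μ : Measure Ω) (m : Ω → ℕ∞) (X : Set Ω) (hX : MeasurableSet X)
    (f g : DirectIntegral μ m) :
    ⟪f, chi μ m X hX g⟫_ℂ =
      ∫ x in X, ⟪(f : Lp EllTwo 2 μ) x, (g : Lp EllTwo 2 μ) x⟫_ℂ ∂μ := by
  rw [Submodule.coe_inner, L2.inner_def, ← integral_indicator hX]
  refine integral_congr_ae ?_
  filter_upwards [chi_ae μ m X hX g] with x h1
  rw [h1]
  by_cases hx : x ∈ X
  · simp only [Set.indicator_of_mem hx]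
  · simp only [Set.indicator_of_notMem hx, inner_zero_right]

theorem chi_comp_chi (μ : Measure Ω) (m : Ω → ℕ∞) (X : Set Ω) (hX : MeasurableSet X) :
    chi μ m X hX ∘L chi μ m X hX = chi μ m X hX := by
  ext1 f
  apply Subtype.ext
  apply Lp.ext
  rw [ContinuousLinearMap.comp_apply]
  filter_upwards [chi_ae μ m X hX f, chi_ae μ m X hX (chi μ m X hX f)] with x h1 h2
  rw [h2]
  by_cases hx : x ∈ X
  · simp only [Set.indicator_of_mem hx]
  · rw [h1]
    simp only [Set.indicator_of_notMem hx]

theorem chi_symm (μ : Measure Ω) (m : Ω → ℕ∞) (X : Set Ω) (hX : MeasurableSet X)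
    (f g : DirectIntegral μ m) : ⟪chi μ m X hX f, g⟫_ℂ = ⟪f, chi μ m X hX g⟫_ℂ := by
  have h := inner_conj_symm (𝕜 := ℂ) (chi μ m X hX f) g
  rw [← h, inner_chi, inner_chi, ← integral_conj]
  simp only [inner_conj_symm]

/-- The canonical spectral measure `X ↦ χ_X` of the direct integral. -/
def canonicalSpectralMeasure (μ : Measure Ω) (m : Ω → ℕ∞) : POVM Ω (DirectIntegral μ m) where
  toFun := chi μ m
  isPositive := by
    intro X hX
    rw [ContinuousLinearMap.isPositive_iff]
    refine ⟨fun f g => chi_symm μ m X hX f g, fun f => ?_⟩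
    have h : chi μ m X hX f = chi μ m X hX (chi μ m X hX f) := by
      rw [← ContinuousLinearMap.comp_apply, chi_comp_chi]
    have h2 := inner_self_eq_norm_sq_to_K (𝕜 := ℂ) (chi μ m X hX f)
    rw [h, chi_symm, h2]
    have h3 : (0 : ℂ) ≤ ((‖chi μ m X hX f‖ ^ 2 : ℝ) : ℂ) := Complex.zero_le_real.2 (sq_nonneg _)
    rw [Complex.ofReal_pow] at h3
    exact h3
  univ_eq_one := by
    ext1 f
    apply Subtype.ext
    apply Lp.ext
    filter_upwards [chi_ae μ m Set.univ MeasurableSet.univ f] with x h1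
    rw [h1]
    simp
  hasSum_iUnion := by
    intro s hs hd f g
    simp only [inner_chi]
    exact hasSum_integral_iUnion hs hd
      (L2.integrable_inner (𝕜 := ℂ) (f : Lp EllTwo 2 μ) (g : Lp EllTwo 2 μ)).integrableOn

theorem canonicalSpectralMeasure_isSharp (μ : Measure Ω) (m : Ω → ℕ∞) :
    (canonicalSpectralMeasure μ m).IsSharp := fun X hX => chi_comp_chi μ m X hX

/-- The observable `M` is rank-`∞`: in its minimal Naimark dilation on a direct integral
`∫^⊕ H_{m(x)} dμ(x)` with the canonical spectral measure, where `μ` is a σ-finite measure such that `μ`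
and `M` are mutually absolutely continuous, the multiplicity `m x` is infinite for almost every `x`.
(Such a dilation is unique up to unitary equivalence, so `m` is determined by `M` almost everywhere.) -/
def IsRankInfinite {H : Type*} [NormedAddCommGroup H] [InnerProductSpace ℂ H] [CompleteSpace H]
    (M : POVM Ω H) : Prop :=
  ∀ (μ : Measure Ω) (_ : SigmaFinite μ) (m : Ω → ℕ∞) (_ : Measurable m)
    (J : H →ₗᵢ[ℂ] DirectIntegral μ m), MutuallyAC μ M →
    IsMinimalNaimarkDilation M (canonicalSpectralMeasure μ m) J → ∀ᵐ x ∂μ, m x = ⊤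

end DirectIntegral

end QM

end

/-! Write `K` for the direct integral carrying `Y`. Both `ψ ↦ ψ ⊗ ξ` and `Y` are isometries of `H`
into `H ⊗ K`, and a unitary carries one to the other exactly when their ranges have equal
codimension. For finite-dimensional `H` this is cancellation of a finite cardinal. Otherwise `H` has
a countably infinite basis, which an infinite codimension absorbs, so it suffices that both
codimensions are infinite (`LinearIsometry.exists_unitary`).

Infinite codimension of `Y` comes from a set where `m = N < ∞`. Since `Y` and `J` both dilate `M`,
`‖(1 ⊗ χ_X) Y φ‖ = ‖χ_X J φ‖` for every `X`. Localizing in `X`, each slice of `Y φ` is dominated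
pointwise by `J φ` up to a Radon–Nikodym density (`ae_enorm_slice_le`). Any `N + 1` vectors `(J
ψⱼ)(x)` in an `N`-dimensional fiber are dependent, and the slices inherit the relation; hence the
matrices `⟨ζ(x), (slice eᵢ (Y ψⱼ))(x)⟩` of size `N + 1` are singular (`ae_det_slice_eq_zero`).
Cofactors turn this into a measurable relation between the rows, valid for all `ψ`
(`exists_measurable_linear_relation`), and so into a nonzero vector `∑ eᵢ ⊗ ηᵢ` orthogonal to the
range of `Y`. Disjoint blocks of an orthonormal system give infinitely many of them.

The range of `ψ ↦ ψ ⊗ ξ` has infinite codimension as soon as `ξ` does not span `K`. If it did,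
suitable `eᵢ` would turn the same matrix into `‖ξ(x)‖²` times the identity, contradicting
singularity (`exists_orthogonal_ne_zero`). -/

/-! ### Invariance of the Hilbert dimension. -/

/-- Each `b₁ i` has a nonzero inner product with only countably many `b₂ j`, and no `b₂ j` is
orthogonal to all `b₁ i`; so `ι₂` is a union of `ι₁` many countable sets. -/
theorem HilbertBasis.mk_le_of_infinite {𝕜 : Type*} {E : Type*} {ι₁ ι₂ : Type u} [RCLike 𝕜]
    [NormedAddCommGroup E] [InnerProductSpace 𝕜 E] [Infinite ι₁]
    (b₁ : HilbertBasis ι₁ 𝕜 E) (b₂ : HilbertBasis ι₂ 𝕜 E) :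
    Cardinal.mk ι₂ ≤ Cardinal.mk ι₁ := by
  have hcover : (⋃ i, {j | inner 𝕜 (b₁ i) (b₂ j) ≠ 0}) = univ := by
    refine eq_univ_of_forall fun j => mem_iUnion.2 ?_
    by_contra! h
    have h0 : b₂ j = 0 := by
      refine (b₁.hasSum_repr (b₂ j)).unique ?_
      have h1 : (fun i => b₁.repr (b₂ j) i • b₁ i) = fun _ => 0 := by
        funext i
        have := h i
        simp only [mem_ofPred_eq, not_not] at this
        rw [b₁.repr_apply_apply, this, zero_smul]
      rw [h1]
      exact hasSum_zero
    have := b₂.orthonormal.1 j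
    simp [h0] at this
  have hcount : ∀ i, Cardinal.mk {j | inner 𝕜 (b₁ i) (b₂ j) ≠ 0} ≤ Cardinal.aleph0 := by
    intro i
    rw [Cardinal.le_aleph0_iff_set_countable]
    refine ((b₂.summable_inner_mul_inner (b₁ i) (b₁ i)).countable_support).mono ?_
    intro j hj
    refine mul_ne_zero hj fun h => hj ?_
    rw [← inner_conj_symm, h, map_zero]
  rw [← Cardinal.mk_univ, ← hcover]
  refine (Cardinal.mk_iUnion_le _).trans ?_
  refine (mul_le_mul_right (ciSup_le' hcount) _).trans ?_
  exact (Cardinal.mul_aleph0_eq (Cardinal.aleph0_le_mk ι₁)).le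

theorem HilbertBasis.mk_eq {𝕜 : Type*} {E : Type*} {ι₁ ι₂ : Type u} [RCLike 𝕜]
    [NormedAddCommGroup E] [InnerProductSpace 𝕜 E]
    (b₁ : HilbertBasis ι₁ 𝕜 E) (b₂ : HilbertBasis ι₂ 𝕜 E) :
    Cardinal.mk ι₁ = Cardinal.mk ι₂ := by
  have hfin : ∀ {κ₁ κ₂ : Type u} (c₁ : HilbertBasis κ₁ 𝕜 E) (c₂ : HilbertBasis κ₂ 𝕜 E),
      Finite κ₁ → Finite κ₂ := by
    intro κ₁ κ₂ c₁ c₂ h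
    have := Fintype.ofFinite κ₁
    have : FiniteDimensional 𝕜 E := c₁.toOrthonormalBasis.toBasis.finiteDimensional_of_finite
    exact c₂.orthonormal.linearIndependent.finite
  cases finite_or_infinite ι₁ with
  | inl h₁ =>
    have h₂ := hfin b₁ b₂ h₁
    have := Fintype.ofFinite ι₁
    have := Fintype.ofFinite ι₂
    rw [Cardinal.mk_fintype, Cardinal.mk_fintype,
      ← Module.finrank_eq_card_basis b₁.toOrthonormalBasis.toBasis,
      ← Module.finrank_eq_card_basis b₂.toOrthonormalBasis.toBasis]
  | inr h₁ =>
    have h₂ : Infinite ι₂ := by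
      by_contra h
      exact not_finite_iff_infinite.2 h₁ (hfin b₂ b₁ (not_infinite_iff_finite.1 h))
    exact le_antisymm (b₂.mk_le_of_infinite b₁) (b₁.mk_le_of_infinite b₂)

/-! ### Unitary extension of isometries with matching codimension. -/

section Extension

variable {𝕜 : Type*} {H E : Type*} [RCLike 𝕜]
  [NormedAddCommGroup H] [InnerProductSpace 𝕜 H] [NormedAddCommGroup E] [InnerProductSpace 𝕜 E]

theorem HilbertBasis.finite_of_finiteDimensional {ι : Type*} [FiniteDimensional 𝕜 E]
    (b : HilbertBasis ι 𝕜 E) : Finite ι := b.orthonormal.linearIndependent.finite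

theorem HilbertBasis.finiteDimensional_of_finite {ι : Type*} [Finite ι]
    (b : HilbertBasis ι 𝕜 E) : FiniteDimensional 𝕜 E := by
  have := Fintype.ofFinite ι
  exact b.toOrthonormalBasis.toBasis.finiteDimensional_of_finite

/-- Distinct basis vectors are at distance `√2`, so the balls of radius `1/2` around them are
disjoint. -/
theorem HilbertBasis.countable [TopologicalSpace.SeparableSpace E] {ι : Type*}
    (b : HilbertBasis ι 𝕜 E) : Countable ι := by
  have hsep : Pairwise (Function.onFun Disjoint fun i => Metric.ball (b i) (1 / 2)) := by
    intro i j hij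
    refine Metric.ball_disjoint_ball ?_
    have h : ‖b i - b j‖ ^ 2 = 2 := by
      rw [@norm_sub_sq 𝕜, b.orthonormal.2 hij, b.orthonormal.1, b.orthonormal.1]
      norm_num
    rw [dist_eq_norm]
    nlinarith [norm_nonneg (b i - b j)]
  exact hsep.countable_of_isOpen_disjoint (fun _ => Metric.isOpen_ball)
    (fun i => ⟨b i, Metric.mem_ball_self (by norm_num)⟩)

/-- A Hilbert basis of the domain of an isometry and one of the orthogonal complement of its range
together form a Hilbert basis of the codomain. -/
theorem LinearIsometry.exists_hilbertBasis_sum [CompleteSpace E] {ι κ : Type*}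
    (b : HilbertBasis ι 𝕜 H) (V : H →ₗᵢ[𝕜] E)
    (c : HilbertBasis κ 𝕜 (LinearMap.range V.toLinearMap)ᗮ) :
    ∃ d : HilbertBasis (ι ⊕ κ) 𝕜 E, ∀ i, d (Sum.inl i) = V (b i) := by
  have ho : Orthonormal 𝕜 (Sum.elim (fun i => V (b i)) fun k => (c k : E)) := by
    constructor
    · rintro (i | k)
      · simpa using b.orthonormal.1 i
      · simpa using c.orthonormal.1 k
    · rintro (i | k) (j | l) hij
      · exact (V.inner_map_map _ _).trans (b.orthonormal.2 (fun h => hij (by rw [h])))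
      · exact (c l).2 _ ⟨b i, rfl⟩
      · exact inner_eq_zero_symm.1 ((c k).2 _ ⟨b j, rfl⟩)
      · exact c.orthonormal.2 (fun h => hij (by rw [h]))
  refine ⟨HilbertBasis.mkOfOrthogonalEqBot ho ?_,
    fun i => congrFun (HilbertBasis.coe_mkOfOrthogonalEqBot ho _) (Sum.inl i)⟩
  rw [Submodule.eq_bot_iff]
  intro x hx
  have hV : x ∈ (LinearMap.range V.toLinearMap)ᗮ := by
    have hz : (innerSL 𝕜 x) ∘L V.toContinuousLinearMap = 0 := by
      refine ContinuousLinearMap.ext_on (s := range b)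
        (Submodule.dense_iff_topologicalClosure_eq_top.2 b.dense_span) ?_
      rintro _ ⟨i, rfl⟩
      exact inner_eq_zero_symm.1 (hx _ (Submodule.subset_span ⟨Sum.inl i, rfl⟩))
    rintro _ ⟨ψ, rfl⟩
    exact inner_eq_zero_symm.1 (congrArg (fun f => f ψ) hz)
  have h0 : (⟨x, hV⟩ : (LinearMap.range V.toLinearMap)ᗮ) = 0 := by
    refine (c.hasSum_repr _).unique ?_
    have h1 : (fun k => c.repr ⟨x, hV⟩ k • c k) = fun _ => 0 := by
      funext k
      have : inner 𝕜 (c k : E) x = 0 := hx _ (Submodule.subset_span ⟨Sum.inr k, rfl⟩)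
      rw [c.repr_apply_apply, Submodule.coe_inner, this, zero_smul]
    rw [h1]
    exact hasSum_zero
  exact congrArg Subtype.val h0

/-- Two isometries of a separable space into a Hilbert space differ by a unitary if both ranges have
infinite codimension, or if their common domain has finite dimension. -/
theorem LinearIsometry.exists_unitary [CompleteSpace H] [CompleteSpace E]
    [TopologicalSpace.SeparableSpace H] (V W : H →ₗᵢ[𝕜] E)
    (hV : ¬ FiniteDimensional 𝕜 H → ¬ FiniteDimensional 𝕜 (LinearMap.range V.toLinearMap)ᗮ)
    (hW : ¬ FiniteDimensional 𝕜 H → ¬ FiniteDimensional 𝕜 (LinearMap.range W.toLinearMap)ᗮ) :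
    ∃ U : E ≃ₗᵢ[𝕜] E, ∀ ψ, U (V ψ) = W ψ := by
  obtain ⟨w, b, -⟩ := exists_hilbertBasis 𝕜 H
  obtain ⟨w₁, c₁, -⟩ := exists_hilbertBasis 𝕜 (LinearMap.range V.toLinearMap)ᗮ
  obtain ⟨w₂, c₂, -⟩ := exists_hilbertBasis 𝕜 (LinearMap.range W.toLinearMap)ᗮ
  obtain ⟨d₁, hd₁⟩ := V.exists_hilbertBasis_sum b c₁
  obtain ⟨d₂, hd₂⟩ := W.exists_hilbertBasis_sum b c₂
  have hcount : Countable w := b.countable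
  have hcard : Cardinal.mk w₁ = Cardinal.mk w₂ := by
    have hsum := d₁.mk_eq d₂
    rw [Cardinal.mk_sum, Cardinal.mk_sum] at hsum
    -- A finite `w` cancels from the cardinal sum; a countably infinite `w` is absorbed by the
    -- infinite `w₁` and `w₂`.
    cases finite_or_infinite w with
    | inl h =>
      have := Cardinal.eq_of_add_eq_add_left hsum
        (Cardinal.lift_lt_aleph0.2 (Cardinal.lt_aleph0_of_finite w))
      exact Cardinal.lift_inj.1 this
    | inr h =>
      have hH : ¬ FiniteDimensional 𝕜 H := fun _ =>
        not_finite_iff_infinite.2 h b.finite_of_finiteDimensional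
      have h₁ : Infinite w₁ := not_finite_iff_infinite.1 fun _ =>
        hV hH c₁.finiteDimensional_of_finite
      have h₂ : Infinite w₂ := not_finite_iff_infinite.1 fun _ =>
        hW hH c₂.finiteDimensional_of_finite
      rw [Cardinal.mk_eq_aleph0 w, Cardinal.lift_aleph0,
        Cardinal.add_eq_right (by simp) (by simp),
        Cardinal.add_eq_right (by simp) (by simp)] at hsum
      exact Cardinal.lift_inj.1 hsum
  obtain ⟨e⟩ := Cardinal.eq.1 hcard
  -- `f` fixes the summand `w`, so the unitary matching the two bases sends `V (b i)` to `W (b i)`.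
  let f : w ⊕ w₁ ≃ w ⊕ w₂ := Equiv.sumCongr (Equiv.refl w) e
  let d : HilbertBasis (w ⊕ w₁) 𝕜 E :=
    HilbertBasis.mk (v := d₂ ∘ f) (d₂.orthonormal.comp f f.injective)
      (by rw [EquivLike.range_comp]; exact d₂.dense_span.ge)
  have hd : ∀ i, d i = d₂ (f i) := fun i => congrFun (HilbertBasis.coe_mk _ _) i
  let U : E ≃ₗᵢ[𝕜] E := d₁.repr.trans d.repr.symm
  have hU : U.toLinearIsometry.toContinuousLinearMap ∘L V.toContinuousLinearMap =
      W.toContinuousLinearMap := by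
    classical
    refine ContinuousLinearMap.ext_on (s := range b)
      (Submodule.dense_iff_topologicalClosure_eq_top.2 b.dense_span) ?_
    rintro _ ⟨i, rfl⟩
    change d.repr.symm (d₁.repr (V (b i))) = W (b i)
    rw [← hd₁, d₁.repr_self, d.repr_symm_single, hd]
    exact hd₂ i
  exact ⟨U, fun ψ => congrArg (fun g => g ψ) hU⟩

end Extension

namespace QM

/-! ### Elementary tensors and slice maps. -/

section Slice

variable {H K G : Type*} [NormedAddCommGroup H] [InnerProductSpace ℂ H]
  [NormedAddCommGroup K] [InnerProductSpace ℂ K] [NormedAddCommGroup G] [NormedSpace ℂ G]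

theorem inner_tmul (ψ ψ' : H) (ξ ξ' : K) :
    ⟪tmul ψ ξ, tmul ψ' ξ'⟫_ℂ = ⟪ψ, ψ'⟫_ℂ * ⟪ξ, ξ'⟫_ℂ := by
  unfold tmul
  rw [UniformSpace.Completion.inner_coe, TensorProduct.inner_tmul]

theorem norm_tmul (ψ : H) (ξ : K) : ‖tmul ψ ξ‖ = ‖ψ‖ * ‖ξ‖ := by
  unfold tmul
  rw [UniformSpace.Completion.norm_coe, TensorProduct.norm_tmul]

/-- Bounded operators on the Hilbert tensor product are determined by their values on elementary
tensors. -/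
theorem HTensor.ext_tmul {A B : HTensor H K →L[ℂ] G} (h : ∀ ψ ξ, A (tmul ψ ξ) = B (tmul ψ ξ)) :
    A = B := by
  ext Φ
  induction Φ using UniformSpace.Completion.induction_on with
  | hp => exact isClosed_eq A.continuous B.continuous
  | ih t =>
    induction t using TensorProduct.induction_on with
    | zero => rw [UniformSpace.Completion.coe_zero, map_zero, map_zero]
    | tmul ψ ξ => exact h ψ ξ
    | add s t hs ht => rw [UniformSpace.Completion.coe_add, map_add, map_add, hs, ht]

/-- The isometry `ψ ↦ ψ ⊗ ξ` for a unit vector `ξ`. -/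
noncomputable def tmulRight (ξ : K) (hξ : ‖ξ‖ = 1) : H →ₗᵢ[ℂ] HTensor H K where
  toFun ψ := tmul ψ ξ
  map_add' ψ φ := by
    unfold tmul
    rw [TensorProduct.add_tmul, UniformSpace.Completion.coe_add]
  map_smul' c ψ := by
    unfold tmul
    rw [← TensorProduct.smul_tmul', UniformSpace.Completion.coe_smul, RingHom.id_apply]
  norm_map' ψ := by
    change ‖tmul ψ ξ‖ = _
    rw [norm_tmul, hξ, mul_one]

/-- The bounded operator `k ↦ e ⊗ k`. -/
noncomputable def tmulLeft (e : H) : K →L[ℂ] HTensor H K :=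
  LinearMap.mkContinuous
    { toFun := fun k => tmul e k
      map_add' := fun k l => by
        unfold tmul
        rw [TensorProduct.tmul_add, UniformSpace.Completion.coe_add]
      map_smul' := fun c k => by
        unfold tmul
        rw [TensorProduct.tmul_smul, UniformSpace.Completion.coe_smul, RingHom.id_apply] }
    ‖e‖ (fun k => (norm_tmul e k).le)

theorem tensorOp_one_comp_self {P : K →L[ℂ] K} (hP : P ∘L P = P) :
    tensorOp (1 : H →L[ℂ] H) P ∘L tensorOp 1 P = tensorOp 1 P := by
  refine HTensor.ext_tmul fun ψ k => ?_
  rw [ContinuousLinearMap.comp_apply, tensorOp_tmul, tensorOp_tmul]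
  exact congrArg (tmul ψ) (congrArg (fun A => A k) hP)

variable [CompleteSpace K]

/-- The slice map `ψ ⊗ k ↦ ⟨e, ψ⟩ k`. -/
noncomputable def slice (e : H) : HTensor H K →L[ℂ] K :=
  ContinuousLinearMap.adjoint (tmulLeft e)

theorem inner_slice (e : H) (k : K) (Φ : HTensor H K) : ⟪k, slice e Φ⟫_ℂ = ⟪tmul e k, Φ⟫_ℂ :=
  ContinuousLinearMap.adjoint_inner_right _ _ _

theorem slice_tmul (e ψ : H) (k : K) : slice e (tmul ψ k) = ⟪e, ψ⟫_ℂ • k := by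
  refine ext_inner_left ℂ fun l => ?_
  rw [inner_slice, inner_tmul, inner_smul_right]

theorem norm_slice_le (e : H) (Φ : HTensor H K) : ‖slice e Φ‖ ≤ ‖e‖ * ‖Φ‖ := by
  refine ((slice e).le_opNorm Φ).trans ?_
  refine mul_le_mul_of_nonneg_right ?_ (norm_nonneg _)
  rw [slice, LinearIsometryEquiv.norm_map]
  exact LinearMap.mkContinuous_norm_le _ (norm_nonneg _) _

/-- Slicing acts on the first factor only. This lets norm bounds for slices be localized to
measurable sets. -/
theorem slice_tensorOp_one (e : H) (P : K →L[ℂ] K) (Φ : HTensor H K) :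
    slice e (tensorOp 1 P Φ) = P (slice e Φ) := by
  have h : slice e ∘L tensorOp 1 P = P ∘L slice e := by
    refine HTensor.ext_tmul fun ψ k => ?_
    rw [ContinuousLinearMap.comp_apply, ContinuousLinearMap.comp_apply, tensorOp_tmul, slice_tmul,
      slice_tmul, map_smul]
    rfl
  exact congrArg (fun A => A Φ) h

theorem adjoint_tensorOp_one {P : K →L[ℂ] K} (hP : ContinuousLinearMap.adjoint P = P) :
    ContinuousLinearMap.adjoint (tensorOp (1 : H →L[ℂ] H) P) = tensorOp 1 P := by
  refine HTensor.ext_tmul fun ψ k => ?_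
  refine ext_inner_left ℂ fun Φ => ?_
  rw [ContinuousLinearMap.adjoint_inner_right, tensorOp_tmul, ← inner_conj_symm,
    ← inner_conj_symm Φ, one_apply_eq_self, ← inner_slice, ← inner_slice,
    slice_tensorOp_one]
  nth_rw 1 [← hP]
  rw [ContinuousLinearMap.adjoint_inner_right]

end Slice

/-- A self-adjoint idempotent `P` satisfies `⟨Φ, P Φ⟩ = ‖P Φ‖²`. -/
theorem inner_projection_self {G : Type*} [NormedAddCommGroup G] [InnerProductSpace ℂ G]
    [CompleteSpace G] {P : G →L[ℂ] G} (hP : ContinuousLinearMap.adjoint P = P) (hP2 : P ∘L P = P)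
    (Φ : G) : ⟪Φ, P Φ⟫_ℂ = ((‖P Φ‖ ^ 2 : ℝ) : ℂ) := by
  have h : ⟪P Φ, P Φ⟫_ℂ = ⟪Φ, P Φ⟫_ℂ := by
    nth_rw 1 [← hP]
    rw [ContinuousLinearMap.adjoint_inner_left, ← ContinuousLinearMap.comp_apply, hP2]
  rw [← h, inner_self_eq_norm_sq_to_K]
  norm_cast

/-! ### Rank-one states and the quadratic form of the associated observable. -/

section RankOne

variable {H : Type*} [NormedAddCommGroup H] [InnerProductSpace ℂ H]

/-- Cauchy–Schwarz followed by Bessel's inequality in each factor. -/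
theorem rankOne_mem_traceClass (ψ φ : H) : InnerProductSpace.rankOne ℂ ψ φ ∈ TraceClass H := by
  refine ⟨‖ψ‖ * ‖φ‖, ?_⟩
  rintro s ⟨n, e, f, he, hf, rfl⟩
  have h1 : ∀ i, ‖⟪e i, InnerProductSpace.rankOne ℂ ψ φ (f i)⟫_ℂ‖ =
      ‖⟪e i, ψ⟫_ℂ‖ * ‖⟪f i, φ⟫_ℂ‖ := by
    intro i
    rw [InnerProductSpace.rankOne_apply, inner_smul_right, norm_mul, norm_inner_symm φ, mul_comm]
  simp only [h1]
  refine (Real.sum_mul_le_sqrt_mul_sqrt _ _ _).trans ?_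
  refine mul_le_mul ?_ ?_ (Real.sqrt_nonneg _) (norm_nonneg _)
  · exact Real.sqrt_le_iff.2 ⟨norm_nonneg _, he.sum_inner_products_le ψ⟩
  · exact Real.sqrt_le_iff.2 ⟨norm_nonneg _, hf.sum_inner_products_le φ⟩

theorem trace_comp_rankOne [CompleteSpace H] (A : H →L[ℂ] H) (ψ φ : H) :
    trace (A ∘L InnerProductSpace.rankOne ℂ ψ φ) = ⟪φ, A ψ⟫_ℂ := by
  rw [← (basis H).tsum_inner_mul_inner φ (A ψ), trace]
  refine tsum_congr fun i => ?_
  rw [ContinuousLinearMap.comp_apply, InnerProductSpace.rankOne_apply, map_smul, inner_smul_right]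

end RankOne

section Observable

variable {Ω : Type*} [MeasurableSpace Ω]
  {H : Type*} [NormedAddCommGroup H] [InnerProductSpace ℂ H] [CompleteSpace H]
  {K : Type*} [NormedAddCommGroup K] [InnerProductSpace ℂ K]

/-- A Stinespring dilation of an instrument yields a Naimark dilation of its associated
observable. -/
theorem IsAssociatedObservable.eq_of_isStinespringDilation {I : Instrument Ω H} {M : POVM Ω H}
    (hM : IsAssociatedObservable I M) {P : POVM Ω K} {Y : H →ₗᵢ[ℂ] HTensor H K}
    (hY : IsStinespringDilation I P Y) (X : Set Ω) (hX : MeasurableSet X) (ψ : H) :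
    ⟪ψ, M.toFun X hX ψ⟫_ℂ = ⟪Y ψ, tensorOp 1 (P.toFun X hX) (Y ψ)⟫_ℂ := by
  -- `M` is tested on states only, so the rank-one projections give the identity for unit vectors;
  -- homogeneity gives the rest.
  have hunit : ∀ φ : H, ‖φ‖ = 1 →
      ⟪φ, M.toFun X hX φ⟫_ℂ = ⟪Y φ, tensorOp 1 (P.toFun X hX) (Y φ)⟫_ℂ := by
    intro φ hφ
    let ρ : TraceClass H := ⟨InnerProductSpace.rankOne ℂ φ φ, rankOne_mem_traceClass φ φ⟩
    have hρ : IsState ρ := by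
      refine ⟨InnerProductSpace.isPositive_rankOne_self φ, ?_⟩
      have := trace_comp_rankOne (1 : H →L[ℂ] H) φ φ
      rw [one_apply_eq_self, inner_self_eq_norm_sq_to_K, hφ] at this
      have h1 : (1 : H →L[ℂ] H) ∘L InnerProductSpace.rankOne ℂ φ φ =
          InnerProductSpace.rankOne ℂ φ φ := ContinuousLinearMap.id_comp _
      rw [h1] at this
      exact this.trans (by norm_num)
    have h1 := hM X hX ρ hρ
    have h2 := hY.2 X hX 1 ρ
    have h3 : (1 : H →L[ℂ] H) ∘L (I.toFun X hX ρ : H →L[ℂ] H) = I.toFun X hX ρ :=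
      ContinuousLinearMap.id_comp _
    rw [h3, ← h1] at h2
    change trace (_ ∘L InnerProductSpace.rankOne ℂ φ φ) =
      trace (_ ∘L InnerProductSpace.rankOne ℂ φ φ) at h2
    rw [trace_comp_rankOne, trace_comp_rankOne] at h2
    rw [← h2, ContinuousLinearMap.comp_apply, ContinuousLinearMap.adjoint_inner_right]
    rfl
  rcases eq_or_ne ψ 0 with rfl | hψ
  · simp
  · have h := hunit ((‖ψ‖ : ℂ)⁻¹ • ψ) (by
      rw [norm_smul, norm_inv, Complex.norm_real, norm_norm, inv_mul_cancel₀ (norm_ne_zero_iff.2 hψ)])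
    have hc : ((‖ψ‖ : ℂ)⁻¹) ≠ 0 := inv_ne_zero (Complex.ofReal_ne_zero.2 (norm_ne_zero_iff.2 hψ))
    simp only [map_smul, inner_smul_left, inner_smul_right] at h
    exact mul_left_cancel₀ ((map_ne_zero _).2 hc) (mul_left_cancel₀ hc h)

end Observable

end QM

/-! ### Measurable families of linear relations. -/

theorem measurable_det_of {Ω : Type*} [MeasurableSpace Ω] {n : ℕ} {h : Fin n → Fin n → Ω → ℂ}
    (hh : ∀ i j, Measurable (h i j)) :
    Measurable fun x => Matrix.det (Matrix.of fun i j => h i j x) := by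
  simp only [Matrix.det_apply, Matrix.of_apply]
  refine Finset.measurable_sum _ fun σ _ => ?_
  exact (Finset.measurable_prod _ fun i _ => hh _ _).const_smul _

/-- If all square matrices formed from the columns `(h i t x)ᵢ` are singular for almost every `x` in a
set of positive measure, then the rows satisfy a measurable nontrivial linear relation on a smaller set
of positive measure. -/
theorem exists_measurable_linear_relation {Ω T : Type*} [MeasurableSpace Ω] (μ : Measure Ω) (n : ℕ)
    (h : Fin n → T → Ω → ℂ) (hh : ∀ i t, Measurable (h i t)) (A : Set Ω) (hA : MeasurableSet A)
    (hμA : μ A ≠ 0)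
    (hdet : ∀ t : Fin n → T, ∀ᵐ x ∂μ, x ∈ A → Matrix.det (Matrix.of fun i j => h i (t j) x) = 0) :
    ∃ c : Fin n → Ω → ℂ, (∀ i, Measurable (c i)) ∧ ∃ B ⊆ A, MeasurableSet B ∧ μ B ≠ 0 ∧
      (∃ i, ∀ x ∈ B, c i x ≠ 0) ∧ ∀ t, ∀ᵐ x ∂μ, x ∈ B → ∑ i, c i x * h i t x = 0 := by
  induction n with
  | zero =>
    -- The empty determinant is `1`, so `hdet` makes `A` a null set.
    refine absurd ?_ hμA
    refine measure_mono_null ?_ (hdet Fin.elim0)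
    intro x hx
    simp [hx]
  | succ n ih =>
    by_cases hminor : ∀ t : Fin n → T, ∀ᵐ x ∂μ, x ∈ A →
        Matrix.det (Matrix.of fun i j => h (Fin.castSucc i) (t j) x) = 0
    · obtain ⟨c, hc, B, hBA, hB, hμB, ⟨i, hi⟩, hrel⟩ :=
        ih (fun i => h i.castSucc) (fun i t => hh _ t) hminor
      refine ⟨Fin.snoc (α := fun _ => Ω → ℂ) c 0, ?_, B, hBA, hB, hμB, ⟨i.castSucc, ?_⟩, ?_⟩
      · refine Fin.lastCases ?_ fun i => ?_
        · rw [Fin.snoc_last]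
          exact measurable_const
        · rw [Fin.snoc_castSucc]
          exact hc i
      · intro x hx
        rw [Fin.snoc_castSucc]
        exact hi x hx
      · intro t
        filter_upwards [hrel t] with x hx hxB
        rw [Fin.sum_univ_castSucc]
        simp only [Fin.snoc_castSucc, Fin.snoc_last, Pi.zero_apply, zero_mul, add_zero]
        exact hx hxB
    · push Not at hminor
      obtain ⟨t, ht⟩ := hminor
      -- Cofactors along the last column of the matrix with columns `t` and one further column. They
      -- do not involve that column, so one choice of `c` serves every `s`; the last cofactor is the
      -- minor that is not almost everywhere zero on `A`.
      let c : Fin (n + 1) → Ω → ℂ := fun i x => (-1) ^ ((i : ℕ) + (Fin.last n : ℕ)) *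
        Matrix.det (Matrix.of fun k j => h (i.succAbove k) (t j) x)
      have hc : ∀ i, Measurable (c i) := fun i =>
        (measurable_det_of (h := fun k j => h (i.succAbove k) (t j)) fun _ _ => hh _ _).const_mul _
      refine ⟨c, hc, A ∩ {x | c (Fin.last n) x ≠ 0}, inter_subset_left,
        hA.inter (hc _ (measurableSet_singleton 0).compl), ?_, ⟨Fin.last n, fun x hx => hx.2⟩, ?_⟩
      · intro h0
        refine ht ?_
        have h1 : ∀ᵐ x ∂μ, x ∉ A ∩ {x | c (Fin.last n) x ≠ 0} := measure_eq_zero_iff_ae_notMem.1 h0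
        filter_upwards [h1] with x hx hxA
        refine hx ⟨hxA.1, mul_ne_zero (pow_ne_zero _ (by norm_num)) ?_⟩
        simpa only [Fin.succAbove_last] using hxA.2
      · intro s
        filter_upwards [hdet (Fin.snoc (α := fun _ => T) t s)] with x hx hxB
        have h1 := hx hxB.1
        rw [Matrix.det_succ_column _ (Fin.last n)] at h1
        rw [← h1]
        refine Finset.sum_congr rfl fun i _ => ?_
        simp only [c, Matrix.of_apply, Fin.snoc_last]
        have h2 : (Matrix.of fun i j => h i (Fin.snoc (α := fun _ => T) t s j) x).submatrix
            i.succAbove (Fin.last n).succAbove =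
            Matrix.of fun k j => h (i.succAbove k) (t j) x := by
          ext k j
          simp only [Matrix.submatrix_apply, Matrix.of_apply, Fin.succAbove_last, Fin.snoc_castSucc]
        rw [h2]
        ring

/-- Domination of all linear combinations almost everywhere, for each choice of coefficients, implies
that almost everywhere each linear relation between the dominating functions is inherited. -/
theorem ae_forall_sum_smul_eq_zero {Ω E F : Type*} [MeasurableSpace Ω] {μ : Measure Ω}
    [NormedAddCommGroup E] [NormedSpace ℂ E] [NormedAddCommGroup F] [NormedSpace ℂ F]
    {n : ℕ} {f : Fin n → Ω → E} {h : Fin n → Ω → F} {g : Ω → ℝ≥0∞} (hg : ∀ᵐ x ∂μ, g x < ∞)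
    (hle : ∀ c : Fin n → ℂ, ∀ᵐ x ∂μ,
      ‖∑ j, c j • h j x‖ₑ ^ (2 : ℝ) ≤ g x * ‖∑ j, c j • f j x‖ₑ ^ (2 : ℝ)) :
    ∀ᵐ x ∂μ, ∀ c : Fin n → ℂ, ∑ j, c j • f j x = 0 → ∑ j, c j • h j x = 0 := by
  -- The exceptional null set depends on `c`. Countably many `c` share one, and closedness of the
  -- inequality in `c`, which uses `g x < ∞`, extends it to all `c`.
  obtain ⟨D, hD, hDd⟩ := TopologicalSpace.exists_countable_dense (Fin n → ℂ)
  have hall : ∀ᵐ x ∂μ, ∀ c ∈ D,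
      ‖∑ j, c j • h j x‖ₑ ^ (2 : ℝ) ≤ g x * ‖∑ j, c j • f j x‖ₑ ^ (2 : ℝ) :=
    (ae_ball_iff hD).2 fun c _ => hle c
  filter_upwards [hall, hg] with x hx hgx c hc
  have hclosed : IsClosed {c : Fin n → ℂ |
      ‖∑ j, c j • h j x‖ₑ ^ (2 : ℝ) ≤ g x * ‖∑ j, c j • f j x‖ₑ ^ (2 : ℝ)} := by
    refine isClosed_le ?_ ?_
    · exact ENNReal.continuous_rpow_const.comp (by fun_prop)
    · exact (ENNReal.continuous_const_mul hgx.ne).comp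
        (ENNReal.continuous_rpow_const.comp (by fun_prop))
  have hcle : c ∈ {c : Fin n → ℂ |
      ‖∑ j, c j • h j x‖ₑ ^ (2 : ℝ) ≤ g x * ‖∑ j, c j • f j x‖ₑ ^ (2 : ℝ)} := by
    have := hclosed.closure_subset_iff.2 hx
    rw [hDd.closure_eq] at this
    exact this (mem_univ c)
  simp only [mem_ofPred_eq, hc, enorm_zero] at hcle
  rw [ENNReal.zero_rpow_of_pos two_pos, mul_zero, nonpos_iff_eq_zero] at hcle
  simpa using hcle

/-! ### Pointwise analysis of the dilation in the direct integral. -/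

namespace QM

/-- Only the coordinates below `N` matter, leaving `N` equations in `N + 1` unknowns. -/
theorem exists_ne_zero_sum_smul_eq_zero_of_mem_fiber {N : ℕ} (v : Fin (N + 1) → EllTwo)
    (hv : ∀ j, v j ∈ fiber (N : ℕ∞)) : ∃ c : Fin (N + 1) → ℂ, c ≠ 0 ∧ ∑ j, c j • v j = 0 := by
  let L : (Fin (N + 1) → ℂ) →ₗ[ℂ] (Fin N → ℂ) :=
    Matrix.toLin' (Matrix.of fun (k : Fin N) (j : Fin (N + 1)) => v j (k : ℕ))
  have hker : LinearMap.ker L ≠ ⊥ := LinearMap.ker_ne_bot_of_finrank_lt (by simp)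
  obtain ⟨c, hc, hc0⟩ := Submodule.exists_mem_ne_zero_of_ne_bot hker
  refine ⟨c, hc0, lp.ext (funext fun k => ?_)⟩
  rw [lp.coeFn_sum, Finset.sum_apply, lp.coeFn_zero, Pi.zero_apply]
  simp only [lp.coeFn_smul, Pi.smul_apply, smul_eq_mul]
  by_cases hk : k < N
  · have := congrFun (LinearMap.mem_ker.1 hc) ⟨k, hk⟩
    simp only [L, Matrix.toLin'_apply, Matrix.mulVec, dotProduct, Matrix.of_apply,
      Pi.zero_apply] at this
    rw [← this]
    exact Finset.sum_congr rfl fun j _ => mul_comm _ _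
  · refine Finset.sum_eq_zero fun j _ => ?_
    rw [hv j k (by exact_mod_cast not_lt.1 hk), mul_zero]

section

variable {Ω : Type*} [MeasurableSpace Ω]

theorem enorm_chi_rpow_two (μ : Measure Ω) (m : Ω → ℕ∞) (X : Set Ω) (hX : MeasurableSet X)
    (f : DirectIntegral μ m) :
    ‖chi μ m X hX f‖ₑ ^ (2 : ℝ) = ∫⁻ x in X, ‖(f : Lp EllTwo 2 μ) x‖ₑ ^ (2 : ℝ) ∂μ := by
  have h1 : ‖chi μ m X hX f‖ₑ = ‖(chi μ m X hX f : Lp EllTwo 2 μ)‖ₑ := rfl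
  rw [h1, Lp.enorm_def, eLpNorm_congr_ae (chi_ae μ m X hX f),
    eLpNorm_indicator_eq_eLpNorm_restrict hX]
  exact eLpNorm_nnreal_pow_eq_lintegral (p := 2) two_ne_zero

end

section

variable {Ω : Type*} [MeasurableSpace Ω]

theorem DirectIntegral.coeFn_sum_smul {μ : Measure Ω} {m : Ω → ℕ∞} {ι : Type*} (s : Finset ι)
    (c : ι → ℂ) (f : ι → DirectIntegral μ m) :
    (((∑ i ∈ s, c i • f i : DirectIntegral μ m) : Lp EllTwo 2 μ) : Ω → EllTwo) =ᵐ[μ]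
      fun x => ∑ i ∈ s, c i • (f i : Lp EllTwo 2 μ) x := by
  classical
  induction s using Finset.induction_on with
  | empty =>
    simp only [Finset.sum_empty, Submodule.coe_zero]
    exact Lp.coeFn_zero _ _ _
  | insert i s hi ih =>
    rw [Finset.sum_insert hi, Submodule.coe_add, Submodule.coe_smul]
    filter_upwards [ih, Lp.coeFn_add (c i • (f i : Lp EllTwo 2 μ))
      ((∑ j ∈ s, c j • f j : DirectIntegral μ m) : Lp EllTwo 2 μ),
      Lp.coeFn_smul (c i) (f i : Lp EllTwo 2 μ)] with x h1 h2 h3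
    rw [h2, Pi.add_apply, h1, h3, Pi.smul_apply, Finset.sum_insert hi]

/-- Multiplication of a vector of the direct integral by a measurable function bounded by `1`. -/
theorem DirectIntegral.exists_smul {μ : Measure Ω} {m : Ω → ℕ∞} (ζ : DirectIntegral μ m)
    {c : Ω → ℂ} (hc : Measurable c) (hc1 : ∀ x, ‖c x‖ ≤ 1) :
    ∃ η : DirectIntegral μ m, ((η : Lp EllTwo 2 μ) : Ω → EllTwo) =ᵐ[μ]
      fun x => c x • (ζ : Lp EllTwo 2 μ) x := by
  have hmem : MemLp (fun x => c x • (ζ : Lp EllTwo 2 μ) x) 2 μ := by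
    refine (Lp.memLp (ζ : Lp EllTwo 2 μ)).of_le
      (hc.aestronglyMeasurable.smul (Lp.aestronglyMeasurable _)) (ae_of_all _ fun x => ?_)
    rw [norm_smul]
    exact mul_le_of_le_one_left (norm_nonneg _) (hc1 x)
  refine ⟨⟨hmem.toLp _, ?_⟩, hmem.coeFn_toLp⟩
  have hζ : ∀ᵐ x ∂μ, (ζ : Lp EllTwo 2 μ) x ∈ fiber (m x) := ζ.2
  change ∀ᵐ x ∂μ, _
  filter_upwards [hζ, hmem.coeFn_toLp] with x h1 h2
  rw [h2]
  exact (fiber (m x)).smul_mem _ h1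

variable {H : Type*} [NormedAddCommGroup H] [InnerProductSpace ℂ H]
  {μ μ' : Measure Ω} {r m : Ω → ℕ∞}
  {Y : H →ₗᵢ[ℂ] HTensor H (DirectIntegral μ r)} {J : H →ₗᵢ[ℂ] DirectIntegral μ' m}

/-- It suffices to compare integrals over each `X`. These are the squared norms of `χ_X (slice e (Y
φ)) = slice e ((1 ⊗ χ_X) Y φ)` and of `χ_X J φ`, and slicing with `‖e‖ ≤ 1` is a contraction. -/
theorem ae_enorm_slice_le [SigmaFinite μ] [SigmaFinite μ'] (hac : μ' ≪ μ)
    (hYJ : ∀ X hX φ, ‖tensorOp 1 (chi μ r X hX) (Y φ)‖ = ‖chi μ' m X hX (J φ)‖)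
    {e : H} (he : ‖e‖ ≤ 1) (φ : H) :
    ∀ᵐ x ∂μ, ‖((slice e (Y φ) : DirectIntegral μ r) : Lp EllTwo 2 μ) x‖ₑ ^ (2 : ℝ) ≤
      μ'.rnDeriv μ x * ‖(J φ : Lp EllTwo 2 μ') x‖ₑ ^ (2 : ℝ) := by
  refine ae_le_of_forall_setLIntegral_le_of_sigmaFinite
    ((Lp.stronglyMeasurable _).enorm.pow_const _) fun X hX _ => ?_
  rw [setLIntegral_rnDeriv_mul hac ((Lp.stronglyMeasurable _).enorm.pow_const _).aemeasurable hX,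
    ← enorm_chi_rpow_two μ r X hX, ← enorm_chi_rpow_two μ' m X hX]
  refine ENNReal.rpow_le_rpow ?_ two_pos.le
  rw [← slice_tensorOp_one, ← ofReal_norm, ← ofReal_norm, ← hYJ]
  refine ENNReal.ofReal_le_ofReal ((norm_slice_le _ _).trans ?_)
  exact mul_le_of_le_one_left (norm_nonneg _) he

/-- A relation between the `N + 1` vectors `(J ψⱼ)(x)` passes to the slices for every `eᵢ` at once,
so its coefficient vector lies in the kernel of the matrix. -/
theorem ae_det_slice_eq_zero [SigmaFinite μ] [SigmaFinite μ'] (hac : μ' ≪ μ) (hac' : μ ≪ μ')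
    (hYJ : ∀ X hX φ, ‖tensorOp 1 (chi μ r X hX) (Y φ)‖ = ‖chi μ' m X hX (J φ)‖)
    {N : ℕ} {e : Fin (N + 1) → H} (he : ∀ i, ‖e i‖ ≤ 1) (ψ : Fin (N + 1) → H)
    (ζ : DirectIntegral μ r) :
    ∀ᵐ x ∂μ, m x = N → Matrix.det (Matrix.of fun i j =>
      ⟪(ζ : Lp EllTwo 2 μ) x, ((slice (e i) (Y (ψ j)) : DirectIntegral μ r) : Lp EllTwo 2 μ) x⟫_ℂ) = 0 := by
  have hrel : ∀ i, ∀ᵐ x ∂μ, ∀ c : Fin (N + 1) → ℂ,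
      ∑ j, c j • (J (ψ j) : Lp EllTwo 2 μ') x = 0 →
      ∑ j, c j • ((slice (e i) (Y (ψ j)) : DirectIntegral μ r) : Lp EllTwo 2 μ) x = 0 := by
    intro i
    refine ae_forall_sum_smul_eq_zero (Measure.rnDeriv_lt_top μ' μ) fun c => ?_
    have h1 := DirectIntegral.coeFn_sum_smul Finset.univ c fun j => slice (e i) (Y (ψ j))
    have h2 := hac'.ae_eq (DirectIntegral.coeFn_sum_smul Finset.univ c fun j => J (ψ j))
    have h3 : ∑ j, c j • slice (e i) (Y (ψ j)) = slice (e i) (Y (∑ j, c j • ψ j)) := by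
      simp only [map_sum, map_smul]
    have h4 : ∑ j, c j • J (ψ j) = J (∑ j, c j • ψ j) := by
      simp only [map_sum, map_smul]
    rw [h3] at h1
    rw [h4] at h2
    filter_upwards [h1, h2, ae_enorm_slice_le hac hYJ (he i) (∑ j, c j • ψ j)] with x k1 k2 k3
    rw [← k1, ← k2]
    exact k3
  have hfib : ∀ᵐ x ∂μ, ∀ j, (J (ψ j) : Lp EllTwo 2 μ') x ∈ fiber (m x) :=
    ae_all_iff.2 fun j => hac'.ae_le (J (ψ j)).2
  filter_upwards [ae_all_iff.2 hrel, hfib] with x hx hf hm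
  rw [hm] at hf
  obtain ⟨c, hc0, hc⟩ := exists_ne_zero_sum_smul_eq_zero_of_mem_fiber _ hf
  refine Matrix.exists_mulVec_eq_zero_iff.1 ⟨c, hc0, funext fun i => ?_⟩
  simp only [Matrix.mulVec, dotProduct, Matrix.of_apply, Pi.zero_apply]
  have := congrArg (fun v => ⟪(ζ : Lp EllTwo 2 μ) x, v⟫_ℂ) (hx i c hc)
  simp only [inner_sum, inner_smul_right, inner_zero_right] at this
  rw [← this]
  exact Finset.sum_congr rfl fun j _ => mul_comm _ _

theorem inner_tmul_sum_eq_integral {ι : Type*} [Fintype ι] (e : ι → H)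
    (η : ι → DirectIntegral μ r) (Φ : HTensor H (DirectIntegral μ r)) :
    ⟪∑ i, tmul (e i) (η i), Φ⟫_ℂ =
      ∫ x, ∑ i, ⟪(η i : Lp EllTwo 2 μ) x, ((slice (e i) Φ : DirectIntegral μ r) : Lp EllTwo 2 μ) x⟫_ℂ ∂μ := by
  refine (sum_inner (𝕜 := ℂ) Finset.univ (fun i => tmul (e i) (η i)) Φ).trans ?_
  rw [integral_finsetSum _ fun i _ => L2.integrable_inner (𝕜 := ℂ) _ _]
  refine Finset.sum_congr rfl fun i _ => ?_
  rw [← inner_slice, Submodule.coe_inner, L2.inner_def]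

/-- If `m = N` and `ζ ≠ 0` on a set of positive measure, then `N + 1` orthonormal vectors `eᵢ` give a nonzero vector
of the form `∑ eᵢ ⊗ ηᵢ` in the orthogonal complement of the range of `Y`. -/
theorem exists_tmul_sum_orthogonal [SigmaFinite μ] [SigmaFinite μ'] (hac : μ' ≪ μ) (hac' : μ ≪ μ')
    (hYJ : ∀ X hX φ, ‖tensorOp 1 (chi μ r X hX) (Y φ)‖ = ‖chi μ' m X hX (J φ)‖)
    (hm : Measurable m) {N : ℕ}
    (ζ : DirectIntegral μ r) (hζ : μ {x | m x = N ∧ (ζ : Lp EllTwo 2 μ) x ≠ 0} ≠ 0)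
    {e : Fin (N + 1) → H} (he : Orthonormal ℂ e) :
    ∃ η : Fin (N + 1) → DirectIntegral μ r, ∑ i, tmul (e i) (η i) ≠ 0 ∧
      ∀ ψ, ⟪∑ i, tmul (e i) (η i), Y ψ⟫_ℂ = 0 := by
  have hA : MeasurableSet {x | m x = N ∧ (ζ : Lp EllTwo 2 μ) x ≠ 0} :=
    (hm (measurableSet_singleton (N : ℕ∞))).inter
      (Lp.stronglyMeasurable (ζ : Lp EllTwo 2 μ)).measurableSet_support
  obtain ⟨c, hc, B, hBA, hB, hμB, ⟨i₀, hi₀⟩, hrel⟩ := exists_measurable_linear_relation μ (N + 1)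
    (fun i ψ x => ⟪(ζ : Lp EllTwo 2 μ) x, ((slice (e i) (Y ψ) : DirectIntegral μ r) : Lp EllTwo 2 μ) x⟫_ℂ)
    (fun i ψ => ((Lp.stronglyMeasurable _).inner (Lp.stronglyMeasurable _)).measurable)
    _ hA hζ (fun ψ => by
      filter_upwards [ae_det_slice_eq_zero hac hac' hYJ (fun i => (he.1 i).le) ψ ζ] with x hx hxA
      exact hx hxA.1)
  -- Dividing by `s` bounds the coefficients by `1`, so that their products with `ζ` stay square
  -- integrable. The conjugate in `d` offsets the conjugate-linearity of the inner product in its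
  -- first argument.
  let s : Ω → ℝ := fun x => 1 + ∑ k, ‖c k x‖
  have hs : ∀ x, 0 < s x := fun x =>
    add_pos_of_pos_of_nonneg one_pos (Finset.sum_nonneg fun _ _ => norm_nonneg _)
  have hsm : Measurable s := measurable_const.add (Finset.measurable_sum _ fun k _ => (hc k).norm)
  let d : Fin (N + 1) → Ω → ℂ := fun i =>
    B.indicator fun x => starRingEnd ℂ (c i x) * ((s x)⁻¹ : ℝ)
  have hd : ∀ i, Measurable (d i) := fun i => Measurable.indicator
    ((RCLike.continuous_conj.measurable.comp (hc i)).mul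
      (Complex.measurable_ofReal.comp hsm.inv)) hB
  have hd1 : ∀ i x, ‖d i x‖ ≤ 1 := by
    intro i x
    refine (norm_indicator_le_norm_self _ _).trans ?_
    rw [norm_mul, RCLike.norm_conj, Complex.norm_real, Real.norm_of_nonneg (inv_nonneg.2 (hs x).le),
      ← div_eq_mul_inv, div_le_one (hs x)]
    have := Finset.single_le_sum (f := fun k => ‖c k x‖) (fun _ _ => norm_nonneg _)
      (Finset.mem_univ i)
    simp only [s]
    linarith
  choose η hη using fun i => ζ.exists_smul (hd i) (hd1 i)
  refine ⟨η, fun h0 => ?_, fun ψ => ?_⟩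
  -- Slicing with `e i₀` isolates `η i₀`, which is nonzero almost everywhere on `B`.
  · have h1 : η i₀ = 0 := by
      have := congrArg (slice (e i₀)) h0
      rw [map_sum, map_zero, Finset.sum_eq_single i₀] at this
      · rw [slice_tmul, inner_self_eq_norm_sq_to_K, he.1] at this
        simpa using this
      · intro j _ hj
        rw [slice_tmul, he.2 hj.symm, zero_smul]
      · simp
    refine hμB (measure_eq_zero_iff_ae_notMem.2 ?_)
    have h2 := hη i₀
    rw [h1, Submodule.coe_zero] at h2
    filter_upwards [h2, Lp.coeFn_zero EllTwo 2 μ] with x k1 k2 hxB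
    rw [k2, Pi.zero_apply] at k1
    refine smul_ne_zero ?_ (hBA hxB).2 k1.symm
    simp only [d, indicator_of_mem hxB]
    exact mul_ne_zero ((map_ne_zero _).2 (hi₀ x hxB))
      (Complex.ofReal_ne_zero.2 (inv_ne_zero (hs x).ne'))
  · rw [inner_tmul_sum_eq_integral]
    refine integral_eq_zero_of_ae ?_
    filter_upwards [hrel ψ, ae_all_iff.2 hη] with x h1 h2
    simp only [h2, inner_smul_left, Pi.zero_apply]
    by_cases hxB : x ∈ B
    · simp only [d, indicator_of_mem hxB, map_mul, Complex.conj_conj, Complex.conj_ofReal]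
      have h3 := h1 hxB
      calc _ = ((s x)⁻¹ : ℝ) * ∑ i, c i x * ⟪(ζ : Lp EllTwo 2 μ) x,
            ((slice (e i) (Y ψ) : DirectIntegral μ r) : Lp EllTwo 2 μ) x⟫_ℂ := by
            rw [Finset.mul_sum]
            exact Finset.sum_congr rfl fun i _ => by ring
        _ = 0 := by rw [h3, mul_zero]
    · simp only [d, indicator_of_notMem hxB, map_zero, zero_mul, Finset.sum_const_zero]

/-- Provides infinitely many mutually orthogonal blocks of `N + 1` vectors, each block yielding one
vector orthogonal to the range of `Y`. -/
theorem exists_orthonormal_nat_prod {H : Type*} [NormedAddCommGroup H] [InnerProductSpace ℂ H]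
    [CompleteSpace H] (hH : ¬ FiniteDimensional ℂ H) (N : ℕ) :
    ∃ e : ℕ × Fin (N + 1) → H, Orthonormal ℂ e := by
  obtain ⟨w, b, -⟩ := exists_hilbertBasis ℂ H
  have hw : Infinite w := not_finite_iff_infinite.1 fun _ => hH b.finiteDimensional_of_finite
  obtain ⟨f, hf⟩ := exists_injective_nat (ℕ × Fin (N + 1))
  exact ⟨_, b.orthonormal.comp (Infinite.natEmbedding w ∘ f)
    ((Infinite.natEmbedding w).injective.comp hf)⟩

theorem not_finiteDimensional_of_orthogonal {E : Type*} [NormedAddCommGroup E]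
    [InnerProductSpace ℂ E] {S : Submodule ℂ E} (v : ℕ → E) (hv : ∀ k, v k ∈ S)
    (hv0 : ∀ k, v k ≠ 0) (ho : Pairwise fun k l => ⟪v k, v l⟫_ℂ = 0) :
    ¬ FiniteDimensional ℂ S := by
  intro _
  have hli : LinearIndependent ℂ fun k => (⟨v k, hv k⟩ : S) :=
    linearIndependent_of_ne_zero_of_inner_eq_zero (fun k h => hv0 k (congrArg Subtype.val h))
      (fun k l hkl => ho hkl)
  exact not_finite_iff_infinite.2 inferInstance hli.finite

theorem inner_tmul_sum_eq_zero {K ι : Type*} [NormedAddCommGroup K] [InnerProductSpace ℂ K]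
    [Fintype ι] {κ : Type*} {e : κ × ι → H} (he : Orthonormal ℂ e) {k l : κ} (hkl : k ≠ l)
    (η θ : ι → K) : ⟪∑ i, tmul (e (k, i)) (η i), ∑ i, tmul (e (l, i)) (θ i)⟫_ℂ = 0 := by
  rw [sum_inner]
  refine Finset.sum_eq_zero fun i _ => ?_
  rw [inner_sum]
  refine Finset.sum_eq_zero fun j _ => ?_
  rw [inner_tmul, he.2 (fun h => hkl (congrArg Prod.fst h)), zero_mul]

end

/-! ### Tensoring with a unit vector, and the case where it spans the second factor. -/

section

variable {H K : Type*} [NormedAddCommGroup H] [InnerProductSpace ℂ H]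
  [NormedAddCommGroup K] [InnerProductSpace ℂ K]

theorem tensorOp_zero_right (B : H →L[ℂ] H) : tensorOp B (0 : K →L[ℂ] K) = 0 := by
  refine HTensor.ext_tmul fun ψ ξ => ?_
  rw [tensorOp_tmul, zero_apply, zero_apply]
  exact map_zero (tmulLeft (B ψ))

theorem eq_inner_smul_of_forall {ξ : K} (hξ : ‖ξ‖ = 1) (h : ∀ η, ⟪ξ, η⟫_ℂ = 0 → η = 0) (η : K) :
    η = ⟪ξ, η⟫_ℂ • ξ := by
  refine sub_eq_zero.1 (h _ ?_)
  rw [inner_sub_right, inner_smul_right, inner_self_eq_norm_sq_to_K, hξ]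
  simp

variable [CompleteSpace H]

theorem tmulRight_surjective {ξ : K} (hξ : ‖ξ‖ = 1) (h : ∀ η, ⟪ξ, η⟫_ℂ = 0 → η = 0) :
    Function.Surjective (tmulRight (H := H) ξ hξ) := by
  have hclosed : IsClosed (range (tmulRight (H := H) ξ hξ)) :=
    (tmulRight ξ hξ).isometry.isClosedEmbedding.isClosed_range
  intro Φ
  induction Φ using UniformSpace.Completion.induction_on with
  | hp => exact hclosed
  | ih t =>
    induction t using TensorProduct.induction_on with
    | zero => exact ⟨0, map_zero (tmulRight ξ hξ)⟩
    | tmul ψ η =>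
      refine ⟨⟪ξ, η⟫_ℂ • ψ, ?_⟩
      change tmul _ ξ = _
      nth_rw 2 [eq_inner_smul_of_forall hξ h η]
      unfold tmul
      rw [TensorProduct.smul_tmul]
    | add s t hs ht =>
      obtain ⟨φ, hφ⟩ := hs
      obtain ⟨φ', hφ'⟩ := ht
      refine ⟨φ + φ', ?_⟩
      rw [map_add, hφ, hφ', UniformSpace.Completion.coe_add]

/-- When `ξ` spans `K`, every `Y (ψ j)` has the form `e j ⊗ ξ`, and the `e j` are again orthonormal.
-/
theorem exists_slice_eq_ite [CompleteSpace K] {n : ℕ} (Y : H →ₗᵢ[ℂ] HTensor H K) {ξ : K}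
    (hξ : ‖ξ‖ = 1) (h : ∀ η, ⟪ξ, η⟫_ℂ = 0 → η = 0) {ψ : Fin n → H} (hψ : Orthonormal ℂ ψ) :
    ∃ e : Fin n → H, (∀ i, ‖e i‖ ≤ 1) ∧ ∀ i j, slice (e i) (Y (ψ j)) = if i = j then ξ else 0 := by
  choose e he using fun j => tmulRight_surjective hξ h (Y (ψ j))
  have hinner : ∀ i j, ⟪e i, e j⟫_ℂ = ⟪ψ i, ψ j⟫_ℂ := by
    intro i j
    rw [← Y.inner_map_map (ψ i), ← he, ← he, LinearIsometry.inner_map_map]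
  refine ⟨e, fun i => ?_, fun i j => ?_⟩
  · rw [← (tmulRight ξ hξ).norm_map, he, Y.norm_map, hψ.1]
  · rw [← he]
    change slice (e i) (tmul (e j) ξ) = _
    rw [slice_tmul, hinner, orthonormal_iff_ite.1 hψ, ite_smul, one_smul, zero_smul]

theorem not_finiteDimensional_range_tmulRight_orthogonal {K : Type*} [NormedAddCommGroup K]
    [InnerProductSpace ℂ K] {ξ : K} (hξ : ‖ξ‖ = 1) {η : K} (hη : ⟪ξ, η⟫_ℂ = 0) (hη0 : η ≠ 0)
    (hH : ¬ FiniteDimensional ℂ H) :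
    ¬ FiniteDimensional ℂ (LinearMap.range (tmulRight (H := H) ξ hξ).toLinearMap)ᗮ := by
  obtain ⟨e, he⟩ := exists_orthonormal_nat_prod hH 0
  refine not_finiteDimensional_of_orthogonal (fun k => tmul (e (k, 0)) η) ?_ ?_ ?_
  · rintro k _ ⟨ψ, rfl⟩
    change ⟪tmul ψ ξ, _⟫_ℂ = 0
    rw [inner_tmul, hη, mul_zero]
  · intro k h0
    have h1 := norm_tmul (e (k, 0)) η
    rw [h0, norm_zero, he.1, one_mul] at h1
    exact hη0 (norm_eq_zero.1 h1.symm)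
  · intro k l hkl
    change ⟪tmul (e (k, 0)) η, tmul (e (l, 0)) η⟫_ℂ = 0
    rw [inner_tmul, he.2 (fun h => hkl (congrArg Prod.fst h)), zero_mul]

/-- An isometry `Y` of `H` into `H ⊗ K` and the isometry `ψ ↦ ψ ⊗ ξ` differ by a unitary if, in case
`H` has infinite dimension, `ξ` does not span `K` and `Y` has infinite codimension. -/
theorem exists_unitary_tmul [CompleteSpace K] [TopologicalSpace.SeparableSpace H]
    (Y : H →ₗᵢ[ℂ] HTensor H K) {ξ : K} (hξ : ‖ξ‖ = 1)
    (h₁ : ¬ FiniteDimensional ℂ H → ∃ η : K, ⟪ξ, η⟫_ℂ = 0 ∧ η ≠ 0)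
    (h₂ : ¬ FiniteDimensional ℂ H → ∃ v : ℕ → HTensor H K, (∀ k, v k ≠ 0) ∧
      (Pairwise fun k l => ⟪v k, v l⟫_ℂ = 0) ∧ ∀ k ψ, ⟪v k, Y ψ⟫_ℂ = 0) :
    ∃ U : HTensor H K ≃ₗᵢ[ℂ] HTensor H K, ∀ ψ : H, U (tmul ψ ξ) = Y ψ := by
  refine (tmulRight ξ hξ).exists_unitary Y (fun hH => ?_) (fun hH => ?_)
  · obtain ⟨η, hη, hη0⟩ := h₁ hH
    exact not_finiteDimensional_range_tmulRight_orthogonal hξ hη hη0 hH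
  · obtain ⟨v, hv0, ho, hv⟩ := h₂ hH
    refine not_finiteDimensional_of_orthogonal v ?_ hv0 ho
    rintro k _ ⟨ψ, rfl⟩
    exact inner_eq_zero_symm.1 (hv k ψ)

end

/-! ### Comparison of the two dilations and infinite codimension. -/

section

variable {Ω : Type*} [MeasurableSpace Ω]
  {H : Type*} [NormedAddCommGroup H] [InnerProductSpace ℂ H]
  {μ μ' : Measure Ω} {r m : Ω → ℕ∞}

theorem MutuallyAC.absolutelyContinuous {M : POVM Ω H} (h : MutuallyAC μ M)
    (h' : MutuallyAC μ' M) : μ ≪ μ' :=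
  Measure.AbsolutelyContinuous.mk fun X hX h0 => (h X hX).2 ((h' X hX).1 h0)

variable [CompleteSpace H]

theorem POVM.IsSharp.inner_eq {K : Type*} [NormedAddCommGroup K] [InnerProductSpace ℂ K]
    [CompleteSpace K] {P : POVM Ω K} (hP : P.IsSharp) (X : Set Ω) (hX : MeasurableSet X) (ξ : K) :
    ⟪ξ, P.toFun X hX ξ⟫_ℂ = ((‖P.toFun X hX ξ‖ ^ 2 : ℝ) : ℂ) :=
  inner_projection_self (P.isPositive X hX).isSelfAdjoint.adjoint_eq (hP X hX) ξ

theorem IsNaimarkDilation.inner_eq {K : Type*} [NormedAddCommGroup K] [InnerProductSpace ℂ K]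
    [CompleteSpace K] {M : POVM Ω H} {P : POVM Ω K} {J : H →ₗᵢ[ℂ] K} (hJ : IsNaimarkDilation M P J)
    (X : Set Ω) (hX : MeasurableSet X) (ψ : H) :
    ⟪ψ, M.toFun X hX ψ⟫_ℂ = ((‖P.toFun X hX (J ψ)‖ ^ 2 : ℝ) : ℂ) := by
  rw [hJ.2 X hX, ContinuousLinearMap.comp_apply, ContinuousLinearMap.adjoint_inner_right]
  exact hJ.1.inner_eq X hX (J ψ)

theorem IsAssociatedObservable.inner_eq {K : Type*} [NormedAddCommGroup K] [InnerProductSpace ℂ K]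
    [CompleteSpace K] {I : Instrument Ω H} {M : POVM Ω H} (hM : IsAssociatedObservable I M)
    {P : POVM Ω K} {Y : H →ₗᵢ[ℂ] HTensor H K} (hY : IsStinespringDilation I P Y)
    (X : Set Ω) (hX : MeasurableSet X) (ψ : H) :
    ⟪ψ, M.toFun X hX ψ⟫_ℂ = ((‖tensorOp 1 (P.toFun X hX) (Y ψ)‖ ^ 2 : ℝ) : ℂ) := by
  rw [hM.eq_of_isStinespringDilation hY]
  exact inner_projection_self
    (adjoint_tensorOp_one (P.isPositive X hX).isSelfAdjoint.adjoint_eq)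
    (tensorOp_one_comp_self (hY.1 X hX)) (Y ψ)

theorem exists_natCast_measure_ne_zero (h : ∃ᵐ x ∂μ, m x ≠ ⊤) :
    ∃ N : ℕ, μ {x | m x = N} ≠ 0 := by
  by_contra! h0
  refine h ?_
  filter_upwards [ae_all_iff.2 fun N => measure_eq_zero_iff_ae_notMem.1 (h0 N)] with x hx hne
  obtain ⟨N, hN⟩ := ENat.ne_top_iff_exists.1 hne
  exact hx N hN.symm

theorem exists_chi_ne_zero {A : Set Ω} (hA : MeasurableSet A) (h : chi μ r A hA ≠ 0) :
    ∃ ζ : DirectIntegral μ r, μ {x | x ∈ A ∧ (ζ : Lp EllTwo 2 μ) x ≠ 0} ≠ 0 := by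
  by_contra! h0
  refine h (ContinuousLinearMap.ext fun ζ => Subtype.ext (Lp.ext ?_))
  rw [zero_apply, Submodule.coe_zero]
  filter_upwards [chi_ae μ r A hA ζ, Lp.coeFn_zero EllTwo 2 μ,
    measure_eq_zero_iff_ae_notMem.1 (h0 ζ)] with x h1 h2 h3
  rw [h1, h2, Pi.zero_apply]
  by_cases hx : x ∈ A
  · rw [indicator_of_mem hx]
    by_contra hne
    exact h3 ⟨hx, hne⟩
  · rw [indicator_of_notMem hx]

variable {Y : H →ₗᵢ[ℂ] HTensor H (DirectIntegral μ r)} {J : H →ₗᵢ[ℂ] DirectIntegral μ' m}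

theorem exists_nat_orthogonal_range [SigmaFinite μ] [SigmaFinite μ'] (hac : μ' ≪ μ)
    (hac' : μ ≪ μ')
    (hYJ : ∀ X hX φ, ‖tensorOp 1 (chi μ r X hX) (Y φ)‖ = ‖chi μ' m X hX (J φ)‖)
    (hm : Measurable m) {N : ℕ} {ζ : DirectIntegral μ r}
    (hζ : μ {x | m x = N ∧ (ζ : Lp EllTwo 2 μ) x ≠ 0} ≠ 0) (hH : ¬ FiniteDimensional ℂ H) :
    ∃ v : ℕ → HTensor H (DirectIntegral μ r), (∀ k, v k ≠ 0) ∧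
      (Pairwise fun k l => ⟪v k, v l⟫_ℂ = 0) ∧ ∀ k ψ, ⟪v k, Y ψ⟫_ℂ = 0 := by
  obtain ⟨e, he⟩ := exists_orthonormal_nat_prod hH N
  choose η hη0 hη using fun k : ℕ => exists_tmul_sum_orthogonal hac hac' hYJ hm ζ hζ
    (he.comp (fun i => (k, i)) (Prod.mk_right_injective k))
  exact ⟨fun k => ∑ i, tmul (e (k, i)) (η k i), hη0,
    fun k l hkl => inner_tmul_sum_eq_zero he hkl _ _, hη⟩

/-- If `m = N` on a set where some vector is nonzero and `H` has infinite dimension, then the direct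
integral is not spanned by a single vector. -/
theorem exists_orthogonal_ne_zero [SigmaFinite μ] [SigmaFinite μ'] (hac : μ' ≪ μ) (hac' : μ ≪ μ')
    (hYJ : ∀ X hX φ, ‖tensorOp 1 (chi μ r X hX) (Y φ)‖ = ‖chi μ' m X hX (J φ)‖)
    {N : ℕ} {ζ : DirectIntegral μ r}
    (hζ : μ {x | m x = N ∧ (ζ : Lp EllTwo 2 μ) x ≠ 0} ≠ 0) (hH : ¬ FiniteDimensional ℂ H)
    {ξ : DirectIntegral μ r} (hξ : ‖ξ‖ = 1) :
    ∃ η : DirectIntegral μ r, ⟪ξ, η⟫_ℂ = 0 ∧ η ≠ 0 := by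
  -- Now `ξ` spans `K`, so `ζ` is a multiple of `ξ`, and it is enough that `ξ` vanishes almost
  -- everywhere on `{m = N}`.
  by_contra! h
  obtain ⟨e', he'⟩ := exists_orthonormal_nat_prod hH N
  let ψ : Fin (N + 1) → H := fun j => e' (0, j)
  have hψ : Orthonormal ℂ ψ := he'.comp _ (Prod.mk_right_injective 0)
  obtain ⟨e, hnorm, hslice⟩ := exists_slice_eq_ite Y hξ h hψ
  refine hζ (measure_eq_zero_iff_ae_notMem.2 ?_)
  have hζξ := Lp.coeFn_smul ⟪ξ, ζ⟫_ℂ (ξ : Lp EllTwo 2 μ)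
  rw [← Submodule.coe_smul, ← eq_inner_smul_of_forall hξ h ζ] at hζξ
  filter_upwards [ae_det_slice_eq_zero hac hac' hYJ hnorm ψ ξ, hζξ, Lp.coeFn_zero EllTwo 2 μ]
    with x hx hζx h0 hxA
  have hdet := hx hxA.1
  have hmat : (Matrix.of fun i j => ⟪(ξ : Lp EllTwo 2 μ) x,
      ((slice (e i) (Y (ψ j)) : DirectIntegral μ r) : Lp EllTwo 2 μ) x⟫_ℂ) =
      Matrix.diagonal fun _ => ⟪(ξ : Lp EllTwo 2 μ) x, (ξ : Lp EllTwo 2 μ) x⟫_ℂ := by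
    ext i j
    rw [Matrix.of_apply, hslice, Matrix.diagonal_apply]
    split_ifs
    · rfl
    · rw [Submodule.coe_zero, h0, Pi.zero_apply, inner_zero_right]
  rw [hmat, Matrix.det_diagonal, Finset.prod_const, Finset.card_univ, Fintype.card_fin,
    pow_eq_zero_iff N.succ_ne_zero] at hdet
  refine hxA.2 ?_
  rw [hζx, Pi.smul_apply, inner_self_eq_zero.1 hdet, smul_zero]

end

end QM

/-! ### The main theorem. -/

theorem mainTheorem2 {Ω : Type*} [MeasurableSpace Ω]
    {H : Type*} [NormedAddCommGroup H] [InnerProductSpace ℂ H] [CompleteSpace H]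
    [TopologicalSpace.SeparableSpace H]
    (I : QM.Instrument Ω H) (M : QM.POVM Ω H) (hM : QM.IsAssociatedObservable I M)
    (μ : Measure Ω) [SigmaFinite μ] (hμ : QM.MutuallyAC μ M)
    (r : Ω → ℕ∞) (hr : Measurable r)
    (Y : H →ₗᵢ[ℂ] QM.HTensor H (QM.DirectIntegral μ r))
    (hY : QM.IsMinimalStinespringDilation I (QM.canonicalSpectralMeasure μ r) Y)
    (hrank : ¬ QM.IsRankInfinite M)
    (ξ : QM.DirectIntegral μ r) (hξ : ‖ξ‖ = 1) :
    ∃ U : QM.HTensor H (QM.DirectIntegral μ r) ≃ₗᵢ[ℂ] QM.HTensor H (QM.DirectIntegral μ r),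
      ∀ ψ : H, U (QM.tmul ψ ξ) = Y ψ := by
  unfold QM.IsRankInfinite at hrank
  push Not at hrank
  obtain ⟨μ', _, m, hm, J, hμ', hJ, hfin⟩ := hrank
  have hac : μ' ≪ μ := hμ'.absolutelyContinuous hμ
  have hac' : μ ≪ μ' := hμ.absolutelyContinuous hμ'
  -- Both squared norms equal `⟨φ, M(X) φ⟩`.
  have hYJ : ∀ X hX φ, ‖QM.tensorOp 1 (QM.chi μ r X hX) (Y φ)‖ = ‖QM.chi μ' m X hX (J φ)‖ := by
    intro X hX φ
    have h := (hM.inner_eq hY.1 X hX φ).symm.trans (hJ.1.inner_eq X hX φ)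
    exact (sq_eq_sq₀ (norm_nonneg _) (norm_nonneg _)).1 (Complex.ofReal_injective h)
  obtain ⟨N, hN⟩ := QM.exists_natCast_measure_ne_zero hfin
  have hA : MeasurableSet {x | m x = N} := hm (measurableSet_singleton (N : ℕ∞))
  -- Otherwise `M` would vanish on `{m = N}`, which has positive `μ'`-measure. This supplies a `ζ`
  -- that does not vanish there.
  have hchi : QM.chi μ r {x | m x = N} hA ≠ 0 := by
    intro h0
    refine hN ((hμ' _ hA).2 ?_)
    rw [← ContinuousLinearMap.coe_inj, ContinuousLinearMap.toLinearMap_zero,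
      ← inner_map_self_eq_zero]
    intro ψ
    refine inner_eq_zero_symm.1 ?_
    refine (hM.inner_eq hY.1 _ hA ψ).trans ?_
    have h2 : ‖QM.tensorOp 1 ((QM.canonicalSpectralMeasure μ r).toFun _ hA) (Y ψ)‖ = 0 := by
      change ‖QM.tensorOp 1 (QM.chi μ r _ hA) (Y ψ)‖ = 0
      rw [h0, QM.tensorOp_zero_right, zero_apply, norm_zero]
    rw [h2]
    simp
  obtain ⟨ζ, hζ⟩ := QM.exists_chi_ne_zero hA hchi
  exact QM.exists_unitary_tmul Y hξ
    (fun hH => QM.exists_orthogonal_ne_zero hac hac' hYJ hζ hH hξ)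
    (fun hH => QM.exists_nat_orthogonal_range hac hac' hYJ hm hζ hH)
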